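/- Let $R$ be a commutative ring; $\otimes=\otimes_R$, algebras and their modules are unital. A \emph{measuring $\alpha$-pairing} $P=(A,C)$ consists of an $R$-algebra $A$, an $R$-coalgebra $C$ and an $R$-algebra morphism $\kappa_P:A\to C^{*}=\mathrm{Hom}_R(C,R)$ (convolution product), written $\langle a,c\rangle=\kappa_P(a)(c)$, such that for every $R$-module $M$ the map $\alpha_M^P:M\otimes C\to \mathrm{Hom}_R(A,M)$, $m\otimes c\mapsto[a\mapsto \langle a,c\rangle m]$, is injective (then $C$ is flat over $R$). A morphism $(\xi,\theta):(B,D)\to(A,C)$ consists of an $R$-algebra morphism $\xi:A\to B$ and an $R$-coalgebra morphism $\theta:D\to C$ with $\langle\xi(a),d\rangle=\langle a,\theta(d)\rangle$ for all $a\in A$, $d\in D$. For a left $A$-module $M$ let $\mathrm{Rat}^C({}_AM)$ be the submodule of those $m\in M$ for which $a\mapsto am$ lies in the image of $\alpha_M^P$; $M$ is $C$-rational if $\mathrm{Rat}^C({}_AM)=M$, and $\mathrm{Rat}^C({}_A\mathcal M)$ is the full subcategory of ${}_A\mathcal M$ of $C$-rational modules. $\mathcal M^C$ is the category of counital right $C$-comodules.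 $C$ is a left $A$-module by $a\rightharpoonup c=\sum c_1\langle a,c_2\rangle$. For a left $A$-module $K$, $\sigma[{}_AK]$ is the full subcategory of ${}_A\mathcal M$ of the modules isomorphic to a submodule of a quotient of a direct sum of copies of $K$, and $\mathrm{Sp}(\sigma[{}_AK],M)$ is the sum of the images of all $A$-linear maps $N\to M$ with $N\in\sigma[{}_AK]$. \textbf{Theorem.} Let $P=(A,C)$ and $Q=(B,D)$ be measuring $\alpha$-pairings and $(\xi,\theta):(B,D)\to(A,C)$ a morphism. Then $(M,\varrho_M)\mapsto(M,\alpha_M^P\circ\varrho_M)$ (the identity on morphisms) is an isomorphism of categories $\mathcal M^C\simeq\mathrm{Rat}^C({}_A\mathcal M)$, one has $\mathrm{Rat}^C({}_A\mathcal M)=\sigma[{}_AC]$, and likewise $\mathcal M^D\simeq\mathrm{Rat}^D({}_B\mathcal M)=\sigma[{}_BD]$. Through these isomorphisms and equalities the following four functors are naturally equivalent: \begin{enumerate} \item $-\square_CD:\mathcal M^C\to\mathcal M^D$, where $D$ is a left $C$-comodule by $(\theta\otimes id)\circ\Delta_D$, $M\square_CD=\ker(\varrho_M\otimes id-id\otimes\varrho_D^C)\subseteq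 M\otimes D$, with the right $D$-coaction induced by $id\otimes\Delta_D$; \item $\mathrm{Coind}_P^Q:\mathrm{Rat}^C({}_A\mathcal M)\to\mathrm{Rat}^D({}_B\mathcal M)$, $M\mapsto\mathrm{Rat}^D(\mathrm{Hom}_A(B,M))$, where $B$ is a left $A$-module through $\xi$ and $(bf)(x)=f(xb)$; \item $\mathrm{Hom}_{A^e}(A,-\otimes D):\mathrm{Rat}^C({}_A\mathcal M)\to\mathrm{Rat}^D({}_B\mathcal M)$, where $A^e=A\otimes A^{op}$ acts on $A$ by $(a\otimes a')x=axa'$ and on $M\otimes D$ by $(a\otimes a')(m\otimes d)=\sum am\otimes\langle a',\theta(d_1)\rangle d_2$, and $(bf)(x)=b\,f(x)$ with $b(m\otimes d)=m\otimes(b\rightharpoonup d)$; \item $\mathrm{Coind}_C^D:\sigma[{}_AC]\to\sigma[{}_BD]$, $M\mapsto\mathrm{Sp}(\sigma[{}_BD],\mathrm{Hom}_A(B,M))$. \end{enumerate} -/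

import Mathlib

open CategoryTheory
open scoped TensorProduct

universe u

noncomputable section

section Pairings

variable {R : Type u} [CommRing R]
variable {V W : Type u} [AddCommGroup V] [Module R V] [AddCommGroup W] [Module R W]

/-- For an `R`-pairing `κ : V → W*` and an `R`-module `M`, the canonical map
`M ⊗ W → Hom_R(V, M)`, `m ⊗ w ↦ (v ↦ ⟨v, w⟩ m)`. -/
def pairingAlpha (κ : V →ₗ[R] W →ₗ[R] R) (M : Type u) [AddCommGroup M] [Module R M] :
    M ⊗[R] W →ₗ[R] V →ₗ[R] M :=
  TensorProduct.lift <| LinearMap.mk₂ R (fun m w => (κ.flip w).smulRight m)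
    (fun m m' w => by ext v; simp) (fun r m w => by ext v; simp [smul_smul, mul_comm])
    (fun m w w' => by ext v; simp [add_smul]) (fun r m w => by ext v; simp [mul_smul])

@[simp]
theorem pairingAlpha_tmul (κ : V →ₗ[R] W →ₗ[R] R) (M : Type u) [AddCommGroup M] [Module R M]
    (m : M) (w : W) (v : V) : pairingAlpha κ M (m ⊗ₜ w) v = κ v w • m := rfl

/-- The `α`-condition on an `R`-pairing: `M ⊗ W → Hom_R(V, M)` is injective for every `R`-module
`M`. -/
def AlphaCondition (κ : V →ₗ[R] W →ₗ[R] R) : Prop :=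
  ∀ (M : Type u) [AddCommGroup M] [Module R M], Function.Injective (pairingAlpha κ M)

theorem pairingAlpha_rTensor (κ : V →ₗ[R] W →ₗ[R] R) {M N : Type u} [AddCommGroup M] [Module R M]
    [AddCommGroup N] [Module R N] (f : M →ₗ[R] N) (t : M ⊗[R] W) (v : V) :
    pairingAlpha κ N (f.rTensor W t) v = f (pairingAlpha κ M t v) := by
  induction t with
  | zero => simp
  | tmul m w => simp
  | add x y hx hy => simp [hx, hy]

theorem AlphaCondition.flat {κ : V →ₗ[R] W →ₗ[R] R} (h : AlphaCondition κ) : Module.Flat R W := by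
  rw [Module.Flat.iff_rTensor_preserves_injective_linearMap]
  intro N N' _ _ _ _ f hf
  rw [injective_iff_map_eq_zero]
  intro t ht
  apply h N
  ext v
  apply hf
  rw [← pairingAlpha_rTensor, ht]
  simp

/-- Membership in `N ⊗ W ⊆ M ⊗ W` is detected by the pairing. -/
theorem AlphaCondition.exists_rTensor {κ : V →ₗ[R] W →ₗ[R] R} (h : AlphaCondition κ)
    {M : Type u} [AddCommGroup M] [Module R M] (N : Submodule R M) (t : M ⊗[R] W)
    (ht : ∀ v, pairingAlpha κ M t v ∈ N) : ∃ s : N ⊗[R] W, N.subtype.rTensor W s = t := by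
  have hex : Function.Exact (N.subtype.rTensor W) (N.mkQ.rTensor W) :=
    rTensor_exact W (LinearMap.exact_subtype_mkQ N) N.mkQ_surjective
  refine (hex t).1 (h _ ?_)
  ext v
  rw [pairingAlpha_rTensor]
  simpa using ht v

end Pairings

section Comodules

variable {R : Type u} [CommRing R] {C : Type u} [AddCommGroup C] [Module R C] [Coalgebra R C]

/-- `ρ : M → M ⊗ C` is a right `C`-comodule structure (coassociative and counital). -/
structure IsRightCoaction {M : Type u} [AddCommGroup M] [Module R M]
    (ρ : M →ₗ[R] M ⊗[R] C) : Prop where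
  coassoc : (TensorProduct.assoc R M C C).toLinearMap ∘ₗ ρ.rTensor C ∘ₗ ρ =
    Coalgebra.comul.lTensor M ∘ₗ ρ
  counit : (TensorProduct.rid R M).toLinearMap ∘ₗ Coalgebra.counit.lTensor M ∘ₗ ρ = LinearMap.id

/-- `lam : N → C ⊗ N` is a left `C`-comodule structure (coassociative and counital). -/
structure IsLeftCoaction {N : Type u} [AddCommGroup N] [Module R N]
    (lam : N →ₗ[R] C ⊗[R] N) : Prop where
  coassoc : (TensorProduct.assoc R C C N).symm.toLinearMap ∘ₗ lam.lTensor C ∘ₗ lam =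
    Coalgebra.comul.rTensor N ∘ₗ lam
  counit : (TensorProduct.lid R N).toLinearMap ∘ₗ Coalgebra.counit.rTensor N ∘ₗ lam = LinearMap.id

variable (R C) in
/-- Objects of the category `M^C` of (counital) right `C`-comodules. -/
structure RightComodule where
  carrier : Type u
  [addCommGroup : AddCommGroup carrier]
  [module : Module R carrier]
  coact : carrier →ₗ[R] carrier ⊗[R] C
  isCoaction : IsRightCoaction coact

attribute [instance] RightComodule.addCommGroup RightComodule.module

namespace RightComodule

/-- Morphisms of right comodules: the `C`-colinear maps. -/
@[ext]
structure Hom (M N : RightComodule R C) where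
  toLin : M.carrier →ₗ[R] N.carrier
  colinear : N.coact ∘ₗ toLin = toLin.rTensor C ∘ₗ M.coact

instance : Category (RightComodule R C) where
  Hom M N := Hom M N
  id M := ⟨LinearMap.id, by simp⟩
  comp f g := ⟨g.toLin ∘ₗ f.toLin, by
    rw [← LinearMap.comp_assoc, g.colinear, LinearMap.comp_assoc, f.colinear,
      ← LinearMap.comp_assoc, LinearMap.rTensor_comp]⟩

@[simp]
theorem id_toLin (M : RightComodule R C) : Hom.toLin (𝟙 M) = LinearMap.id := rfl

@[simp]
theorem comp_toLin {M N L : RightComodule R C} (f : M ⟶ N) (g : N ⟶ L) :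
    Hom.toLin (f ≫ g) = Hom.toLin g ∘ₗ Hom.toLin f := rfl

@[ext]
theorem hom_ext {M N : RightComodule R C} {f g : M ⟶ N} (h : Hom.toLin f = Hom.toLin g) : f = g :=
  Hom.ext h

end RightComodule

/-- The cotensor product `M □_C N ⊆ M ⊗ N`: the kernel of `ρ ⊗ id - id ⊗ lam`. -/
def cotensor {M N : Type u} [AddCommGroup M] [Module R M] [AddCommGroup N] [Module R N]
    (ρ : M →ₗ[R] M ⊗[R] C) (lam : N →ₗ[R] C ⊗[R] N) : Submodule R (M ⊗[R] N) :=
  LinearMap.ker ((TensorProduct.assoc R M C N).toLinearMap ∘ₗ ρ.rTensor N - lam.lTensor M)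

/-- For a coalgebra morphism `θ : D → C`, the left `C`-comodule structure
`(θ ⊗ id) ∘ Δ_D` of `D`. -/
def leftCoactOfHom {D : Type u} [AddCommGroup D] [Module R D] [Coalgebra R D] (θ : D →ₗc[R] C) :
    D →ₗ[R] C ⊗[R] D :=
  θ.toLinearMap.rTensor D ∘ₗ Coalgebra.comul

theorem isLeftCoaction_leftCoactOfHom {D : Type u} [AddCommGroup D] [Module R D] [Coalgebra R D]
    (θ : D →ₗc[R] C) : IsLeftCoaction (leftCoactOfHom θ) where
  coassoc := by
    have h1 := Coalgebra.coassoc_symm (R := R) (A := D)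
    have h2 : TensorProduct.map θ.toLinearMap θ.toLinearMap ∘ₗ Coalgebra.comul =
      Coalgebra.comul ∘ₗ θ.toLinearMap := θ.map_comp_comul
    have h3 : (TensorProduct.assoc R C C D).symm.toLinearMap ∘ₗ
        (leftCoactOfHom θ).lTensor C ∘ₗ θ.toLinearMap.rTensor D =
        (TensorProduct.map θ.toLinearMap θ.toLinearMap).rTensor D ∘ₗ
          (TensorProduct.assoc R D D D).symm.toLinearMap ∘ₗ Coalgebra.comul.lTensor D := by
      ext x y
      simp only [leftCoactOfHom, LinearMap.lTensor_comp, TensorProduct.AlgebraTensorModule.curry_apply,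
        TensorProduct.curry_apply, LinearMap.coe_restrictScalars, LinearMap.comp_apply,
        LinearMap.rTensor_tmul, LinearMap.lTensor_tmul]
      generalize (Coalgebra.comul (R := R) y) = z
      induction z with
      | zero => simp
      | tmul a b => simp
      | add a b ha hb => simp only [map_add, TensorProduct.tmul_add, ha, hb]
    calc _ = ((TensorProduct.assoc R C C D).symm.toLinearMap ∘ₗ
        (leftCoactOfHom θ).lTensor C ∘ₗ θ.toLinearMap.rTensor D) ∘ₗ Coalgebra.comul := rfl
      _ = (TensorProduct.map θ.toLinearMap θ.toLinearMap).rTensor D ∘ₗ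
          ((TensorProduct.assoc R D D D).symm.toLinearMap ∘ₗ Coalgebra.comul.lTensor D
            ∘ₗ Coalgebra.comul) := by rw [h3]; rfl
      _ = (TensorProduct.map θ.toLinearMap θ.toLinearMap ∘ₗ Coalgebra.comul).rTensor D ∘ₗ
            Coalgebra.comul := by
          rw [h1, LinearMap.rTensor_comp]; rfl
      _ = _ := by rw [h2, LinearMap.rTensor_comp]; rfl
  counit := by
    have h2 : Coalgebra.counit ∘ₗ θ.toLinearMap = Coalgebra.counit (R := R) := θ.counit_comp
    have h3 : Coalgebra.counit.rTensor D ∘ₗ leftCoactOfHom θ =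
        Coalgebra.counit.rTensor D ∘ₗ Coalgebra.comul := by
      rw [← h2, LinearMap.rTensor_comp]; rfl
    rw [h3]
    ext x
    simp

end Comodules

section Measuring

variable (R A C : Type u) [CommRing R] [Ring A] [Algebra R A]
  [AddCommGroup C] [Module R C] [Coalgebra R C]

/-- A measuring `R`-pairing `(A, C)`: an `R`-algebra morphism from `A` to the convolution algebra
`C* = Hom_R(C, R)`. -/
structure MeasuringPairing where
  toDual : A →ₐ[R] WithConv (C →ₗ[R] R)

variable {R A C}

/-- The bilinear form `⟨a, c⟩` of a measuring pairing. -/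
def MeasuringPairing.form (P : MeasuringPairing R A C) : A →ₗ[R] C →ₗ[R] R :=
  (WithConv.linearEquiv R (C →ₗ[R] R)).toLinearMap ∘ₗ P.toDual.toLinearMap

variable (R A C) in
/-- A measuring `α`-pairing: a measuring pairing that satisfies the `α`-condition. -/
structure MeasuringAlphaPairing extends MeasuringPairing R A C where
  alpha : AlphaCondition toMeasuringPairing.form

/-- A morphism `(ξ, θ) : (B, D) → (A, C)` of measuring pairings. -/
structure MeasuringPairing.Hom {B D : Type u} [Ring B] [Algebra R B] [AddCommGroup D] [Module R D]
    [Coalgebra R D] (Q : MeasuringPairing R B D) (P : MeasuringPairing R A C) where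
  ξ : A →ₐ[R] B
  θ : D →ₗc[R] C
  adj : ∀ a d, Q.form (ξ a) d = P.form a (θ d)

namespace MeasuringPairing

variable (P : MeasuringPairing R A C)

theorem form_one (c : C) : P.form 1 c = Coalgebra.counit (R := R) c := by
  simp [form, LinearMap.convOne_def]

theorem form_mul (a b : A) (c : C) : P.form (a * b) c =
    LinearMap.mul' R R (TensorProduct.map (P.form a) (P.form b) (Coalgebra.comul (R := R) c)) := by
  simp [form, LinearMap.convMul_def]

section Actions

variable {M : Type u} [AddCommGroup M] [Module R M]

/-- For a right `C`-comodule `(M, ρ)`, the left `A`-action `α_M ∘ ρ` on `M`, that is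
`a m = ∑ m₀ ⟨a, m₁⟩`. -/
def leftActLin (ρ : M →ₗ[R] M ⊗[R] C) : A →ₗ[R] Module.End R M :=
  (pairingAlpha P.form M ∘ₗ ρ).flip

theorem leftActLin_apply (ρ : M →ₗ[R] M ⊗[R] C) (a : A) (m : M) :
    P.leftActLin ρ a m = pairingAlpha P.form M (ρ m) a := rfl

theorem pairingAlpha_mul (t : M ⊗[R] C) (a b : A) :
    pairingAlpha P.form M t (a * b) =
      pairingAlpha P.form M (pairingAlpha P.form (M ⊗[R] C)
        ((TensorProduct.assoc R M C C).symm (Coalgebra.comul.lTensor M t)) b) a := by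
  induction t with
  | zero => simp
  | add x y hx hy => simp only [map_add, LinearMap.add_apply, hx, hy]
  | tmul m c =>
    rw [pairingAlpha_tmul, form_mul, LinearMap.lTensor_tmul]
    generalize (Coalgebra.comul (R := R) c) = z
    induction z with
    | zero => simp
    | tmul c d => simp [smul_smul, mul_comm]
    | add x y hx hy => simp only [map_add, LinearMap.add_apply, TensorProduct.tmul_add, add_smul,
        hx, hy]

theorem pairingAlpha_one (t : M ⊗[R] C) :
    pairingAlpha P.form M t 1 = TensorProduct.rid R M (Coalgebra.counit.lTensor M t) := by
  induction t with
  | zero => simp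
  | add x y hx hy => simp only [map_add, LinearMap.add_apply, hx, hy]
  | tmul m c => simp [form_one]

/-- The left `A`-action on a right `C`-comodule, as an algebra morphism `A → End_R(M)`. -/
def leftAct (ρ : M →ₗ[R] M ⊗[R] C) (hρ : IsRightCoaction ρ) : A →ₐ[R] Module.End R M :=
  AlgHom.ofLinearMap (P.leftActLin ρ)
    (by
      ext m
      rw [leftActLin_apply, pairingAlpha_one]
      exact LinearMap.congr_fun hρ.counit m)
    (fun a b => by
      ext m
      have h : Coalgebra.comul.lTensor M (ρ m) =
          TensorProduct.assoc R M C C (ρ.rTensor C (ρ m)) :=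
        (LinearMap.congr_fun hρ.coassoc m).symm
      rw [leftActLin_apply, pairingAlpha_mul, h, LinearEquiv.symm_apply_apply,
        pairingAlpha_rTensor]
      rfl)

theorem leftAct_apply (ρ : M →ₗ[R] M ⊗[R] C) (hρ : IsRightCoaction ρ) (a : A) (m : M) :
    P.leftAct ρ hρ a m = pairingAlpha P.form M (ρ m) a := rfl

/-- For a left `C`-comodule `(N, lam)`, the right `A`-action `n a = ∑ ⟨a, n₋₁⟩ n₀` on `N`. -/
def rightActLin (lam : M →ₗ[R] C ⊗[R] M) : A →ₗ[R] Module.End R M :=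
  (pairingAlpha P.form M ∘ₗ (TensorProduct.comm R C M).toLinearMap ∘ₗ lam).flip

theorem rightActLin_apply (lam : M →ₗ[R] C ⊗[R] M) (a : A) (m : M) :
    P.rightActLin lam a m = pairingAlpha P.form M (TensorProduct.comm R C M (lam m)) a := rfl

/-- The right `A`-action on a left `C`-comodule, as an algebra morphism `Aᵒᵖ → End_R(N)`. -/
def rightAct (lam : M →ₗ[R] C ⊗[R] M) (hl : IsLeftCoaction lam) :
    Aᵐᵒᵖ →ₐ[R] Module.End R M :=
  AlgHom.ofLinearMap (P.rightActLin lam ∘ₗ (MulOpposite.opLinearEquiv R).symm.toLinearMap)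
    (by
      ext m
      have h := LinearMap.congr_fun hl.counit m
      simp only [LinearMap.comp_apply, LinearEquiv.coe_coe] at h
      simp only [LinearMap.comp_apply, LinearEquiv.coe_coe, MulOpposite.coe_opLinearEquiv_symm,
        MulOpposite.unop_one, rightActLin_apply, pairingAlpha_one, Module.End.one_apply]
      refine Eq.trans ?_ h
      generalize lam m = t
      induction t with
      | zero => simp
      | add x y hx hy => simp only [map_add, hx, hy]
      | tmul c n => simp)
    (fun a b => by
      ext m
      have h := LinearMap.congr_fun hl.coassoc m
      simp only [LinearMap.comp_apply, LinearEquiv.coe_coe] at h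
      have key : ∀ (x y : A) (t : C ⊗[R] M),
          pairingAlpha P.form M (TensorProduct.comm R C M t) (x * y) =
          pairingAlpha P.form M (TensorProduct.comm R C M (TensorProduct.lid R _
            ((P.form x).rTensor (C ⊗[R] M) (TensorProduct.assoc R C C M
              (Coalgebra.comul.rTensor M t))))) y := by
        intro x y t
        induction t with
        | zero => simp
        | add s t hs ht => simp only [map_add, LinearMap.add_apply, hs, ht]
        | tmul c n =>
          rw [TensorProduct.comm_tmul, pairingAlpha_tmul, form_mul, LinearMap.rTensor_tmul]
          generalize (Coalgebra.comul (R := R) c) = z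
          induction z with
          | zero => simp
          | tmul c d => simp [smul_smul]
          | add s t hs ht => simp only [map_add, LinearMap.add_apply, TensorProduct.add_tmul,
              add_smul, hs, ht]
      have key2 : ∀ (x : A) (t : C ⊗[R] M),
          TensorProduct.lid R (C ⊗[R] M) ((P.form x).rTensor (C ⊗[R] M) (lam.lTensor C t)) =
            lam (pairingAlpha P.form M (TensorProduct.comm R C M t) x) := by
        intro x t
        induction t with
        | zero => simp
        | add s t hs ht => simp only [map_add, LinearMap.add_apply, hs, ht]
        | tmul c n => simp
      simp only [LinearMap.comp_apply, LinearEquiv.coe_coe, MulOpposite.coe_opLinearEquiv_symm,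
        MulOpposite.unop_mul, rightActLin_apply, Module.End.mul_apply]
      rw [key, ← h, LinearEquiv.apply_symm_apply, key2])

theorem rightAct_apply (lam : M →ₗ[R] C ⊗[R] M) (hl : IsLeftCoaction lam) (a : A) (m : M) :
    P.rightAct lam hl (MulOpposite.op a) m =
      pairingAlpha P.form M (TensorProduct.comm R C M (lam m)) a := rfl

end Actions

end MeasuringPairing

theorem isRightCoaction_comul : IsRightCoaction (Coalgebra.comul (R := R) (A := C)) where
  coassoc := Coalgebra.coassoc
  counit := by ext; simp

/-- The coalgebra `C` as a left `A`-module through `a ⇀ c = ∑ c₁ ⟨a, c₂⟩`. -/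
def MeasuringPairing.leftModule (P : MeasuringPairing R A C) : ModuleCat.{u} A :=
  letI : Module A C := Module.compHom C (P.leftAct _ isRightCoaction_comul).toRingHom
  ModuleCat.of A C

end Measuring

section Rational

variable {R A C : Type u} [CommRing R] [Ring A] [Algebra R A]
  [AddCommGroup C] [Module R C] [Coalgebra R C]

namespace MeasuringPairing

variable (P : MeasuringPairing R A C)

theorem pairingAlpha_lTensor_leftAct {M : Type u} [AddCommGroup M] [Module R M] (t : M ⊗[R] C)
    (a b : A) :
    pairingAlpha P.form M ((P.leftAct _ isRightCoaction_comul b).lTensor M t) a =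
      pairingAlpha P.form M t (a * b) := by
  induction t with
  | zero => simp
  | add x y hx hy => simp only [map_add, LinearMap.add_apply, hx, hy]
  | tmul m c =>
    rw [LinearMap.lTensor_tmul, leftAct_apply, pairingAlpha_tmul, pairingAlpha_tmul, form_mul]
    congr 1
    generalize (Coalgebra.comul (R := R) c) = z
    induction z with
    | zero => simp
    | tmul c d => simp [mul_comm]
    | add x y hx hy => simp only [map_add, LinearMap.add_apply, hx, hy]

section

variable (M : Type u) [AddCommGroup M] [Module R M] [Module A M]

/-- `Rat^C(_A M) = ρ_M⁻¹(M ⊗ C)`: the elements `m` of `M` for which the map `a ↦ a m` lies in the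
image of `M ⊗ C → Hom_R(A, M)`. -/
def ratSubmodule : Submodule A M where
  carrier := {m | ∃ t : M ⊗[R] C, ∀ a : A, a • m = pairingAlpha P.form M t a}
  zero_mem' := ⟨0, by simp⟩
  add_mem' := by
    rintro m n ⟨s, hs⟩ ⟨t, ht⟩
    exact ⟨s + t, fun a => by simp [hs, ht]⟩
  smul_mem' := by
    rintro b m ⟨t, ht⟩
    refine ⟨(P.leftAct _ isRightCoaction_comul b).lTensor M t, fun a => ?_⟩
    rw [pairingAlpha_lTensor_leftAct, ← ht, mul_smul]

theorem mem_ratSubmodule {m : M} :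
    m ∈ P.ratSubmodule M ↔ ∃ t : M ⊗[R] C, ∀ a : A, a • m = pairingAlpha P.form M t a := Iff.rfl

/-- A left `A`-module `M` is `C`-rational if `Rat^C(_A M) = M`. -/
def IsRational : Prop := P.ratSubmodule M = ⊤

theorem isRational_iff : P.IsRational M ↔
    ∀ m : M, ∃ t : M ⊗[R] C, ∀ a : A, a • m = pairingAlpha P.form M t a := by
  simp [IsRational, Submodule.eq_top_iff', mem_ratSubmodule]

end

/-- Rationality does not depend on how the induced `R`-module structure is presented. -/
theorem isRational_congr {M : Type u} [AddCommGroup M] [Module A M] (i₁ i₂ : Module R M)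
    (h₁ : @IsScalarTower R A M _ _ i₁.toSMul) (h₂ : @IsScalarTower R A M _ _ i₂.toSMul)
    (h : @IsRational R A C _ _ _ _ _ _ P M _ i₁ _) : @IsRational R A C _ _ _ _ _ _ P M _ i₂ _ := by
  have : i₁ = i₂ := by
    refine Module.ext' _ _ fun r m => ?_
    have e₁ : algebraMap R A r • m = i₁.toSMul.smul r m :=
      letI := i₁
      algebraMap_smul A r m
    have e₂ : algebraMap R A r • m = i₂.toSMul.smul r m :=
      letI := i₂
      algebraMap_smul A r m
    exact e₁.symm.trans e₂
  subst this
  exact h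

end MeasuringPairing

namespace MeasuringAlphaPairing

variable (P : MeasuringAlphaPairing R A C)

/-- An `A`-linear injection pulls rational elements back to rational elements. -/
theorem mem_ratSubmodule_of_injective {M N : Type u} [AddCommGroup M] [Module R M] [Module A M]
    [IsScalarTower R A M] [AddCommGroup N] [Module R N] [Module A N] [IsScalarTower R A N]
    (f : M →ₗ[A] N) (hf : Function.Injective f) (m : M) (hm : f m ∈ P.ratSubmodule N) :
    m ∈ P.ratSubmodule M := by
  obtain ⟨t, ht⟩ := hm
  set g : M →ₗ[R] N := f.restrictScalars R
  obtain ⟨s, hs⟩ := P.alpha.exists_rTensor (LinearMap.range g) t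
    (fun a => ⟨a • m, by rw [← ht]; exact f.map_smul a m⟩)
  let e := LinearEquiv.ofInjective g hf
  refine ⟨e.symm.toLinearMap.rTensor C s, fun a => hf ?_⟩
  have h1 : f (pairingAlpha P.form M (e.symm.toLinearMap.rTensor C s) a) =
      pairingAlpha P.form N (g.rTensor C (e.symm.toLinearMap.rTensor C s)) a :=
    (pairingAlpha_rTensor _ g _ _).symm
  have h2 : g ∘ₗ e.symm.toLinearMap = (LinearMap.range g).subtype := by
    ext x
    obtain ⟨y, rfl⟩ := e.surjective x
    simp only [LinearMap.comp_apply, LinearEquiv.coe_coe, LinearEquiv.symm_apply_apply]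
    rfl
  rw [h1, ← LinearMap.comp_apply (LinearMap.rTensor C g), ← LinearMap.rTensor_comp, h2, hs, ← ht,
    map_smul]

theorem isRational_ratSubmodule (M : Type u) [AddCommGroup M] [Module R M] [Module A M]
    [IsScalarTower R A M] : P.IsRational (P.ratSubmodule M) := by
  refine Submodule.eq_top_iff'.2 fun m => ?_
  exact P.mem_ratSubmodule_of_injective (P.ratSubmodule M).subtype
    (Submodule.injective_subtype _) m m.2

end MeasuringAlphaPairing

/-- A module over an `R`-algebra, viewed as an `R`-module. -/
@[reducible]
def baseModule (M : ModuleCat.{u} A) : Module R M := Module.restrictScalars R A M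

attribute [local instance] baseModule

theorem baseModule_isScalarTower (M : ModuleCat.{u} A) : IsScalarTower R A M :=
  IsScalarTower.restrictScalars R A M

attribute [local instance] baseModule_isScalarTower

namespace MeasuringPairing

variable (P : MeasuringPairing R A C)

/-- The `C`-rational left `A`-modules, as a property of objects of `_A M`; the full subcategory
is `Rat^C(_A M)`. -/
def ratProp : ObjectProperty (ModuleCat.{u} A) := fun M => P.IsRational M

/-- The category `Rat^C(_A M)`. -/
abbrev RatCat : Type (u + 1) := P.ratProp.FullSubcategory

theorem ratProp_of {M : Type u} [AddCommGroup M] [Module R M] [Module A M] [IsScalarTower R A M]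
    (h : P.IsRational M) : P.ratProp (ModuleCat.of A M) :=
  P.isRational_congr (M := M) _ _ inferInstance
    (baseModule_isScalarTower (R := R) (ModuleCat.of A M)) h

/-- The left `A`-module structure of a right `C`-comodule. -/
@[reducible]
def comoduleModule (M : RightComodule R C) : Module A M.carrier :=
  Module.compHom M.carrier (P.leftAct M.coact M.isCoaction).toRingHom

theorem comoduleModule_isScalarTower (M : RightComodule R C) :
    letI := P.comoduleModule M
    IsScalarTower R A M.carrier := by
  let _ := P.comoduleModule M
  refine ⟨fun r a m => ?_⟩
  change P.leftAct M.coact M.isCoaction (r • a) m = r • P.leftAct M.coact M.isCoaction a m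
  simp

/-- The functor `M^C → Rat^C(_A M)`, `(M, ρ) ↦ (M, α_M ∘ ρ)`, the identity on morphisms. -/
def toRat : RightComodule R C ⥤ P.RatCat where
  obj M :=
    letI := P.comoduleModule M
    { obj := ModuleCat.of A M.carrier
      property :=
        haveI := P.comoduleModule_isScalarTower M
        P.ratProp_of ((P.isRational_iff M.carrier).2 fun m => ⟨M.coact m, fun _ => rfl⟩) }
  map {M N} f :=
    letI := P.comoduleModule M
    letI := P.comoduleModule N
    ObjectProperty.homMk <| ModuleCat.ofHom
      { toFun := RightComodule.Hom.toLin f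
        map_add' := map_add _
        map_smul' := fun a m => by
          change (RightComodule.Hom.toLin f) (pairingAlpha P.form _ (M.coact m) a) =
            pairingAlpha P.form _ (N.coact (RightComodule.Hom.toLin f m)) a
          rw [← pairingAlpha_rTensor]
          congr 2
          exact (LinearMap.congr_fun (RightComodule.Hom.colinear f) m).symm }

theorem map_mem_ratSubmodule {M N : Type u} [AddCommGroup M] [Module R M] [Module A M]
    [IsScalarTower R A M] [AddCommGroup N] [Module R N] [Module A N] [IsScalarTower R A N]
    (f : M →ₗ[A] N) {m : M} (hm : m ∈ P.ratSubmodule M) : f m ∈ P.ratSubmodule N := by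
  obtain ⟨t, ht⟩ := hm
  refine ⟨(f.restrictScalars R).rTensor C t, fun a => ?_⟩
  rw [pairingAlpha_rTensor, ← ht]
  exact (f.map_smul a m).symm

end MeasuringPairing

/-- The functor `Rat^C : _A M → Rat^C(_A M)`. -/
def MeasuringAlphaPairing.ratFunctor (P : MeasuringAlphaPairing R A C) :
    ModuleCat.{u} A ⥤ P.RatCat where
  obj M := ⟨ModuleCat.of A (P.ratSubmodule M), P.ratProp_of (P.isRational_ratSubmodule M)⟩
  map f := ObjectProperty.homMk <| ModuleCat.ofHom <|
    f.hom.restrict fun _ hm => P.map_mem_ratSubmodule f.hom hm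

end Rational

section Subgenerated

variable {A B : Type u} [Ring A] [Ring B]

/-- `σ[_A K]`: the left `A`-modules isomorphic to a submodule of a `K`-generated module (a quotient
of a direct sum `K^(I)`). -/
def sigmaProp (K : ModuleCat.{u} A) : ObjectProperty (ModuleCat.{u} A) := fun N =>
  ∃ (I : Type u) (X : ModuleCat.{u} A) (p : (I →₀ K) →ₗ[A] X) (i : N →ₗ[A] X),
    Function.Surjective p ∧ Function.Injective i

/-- The full subcategory `σ[_A K]` of `_A M`. -/
abbrev SigmaCat (K : ModuleCat.{u} A) : Type (u + 1) := (sigmaProp K).FullSubcategory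

/-- `Sp(σ[_A K], M)`: the sum of the images of all `A`-linear maps `N → M` with `N ∈ σ[_A K]`. -/
def sigmaTrace (K M : ModuleCat.{u} A) : Submodule A M :=
  ⨆ (N : ModuleCat.{u} A) (_ : sigmaProp K N) (f : N →ₗ[A] M), LinearMap.range f

theorem sigmaProp_of_surjective (K : ModuleCat.{u} A) {N N' : ModuleCat.{u} A}
    (hN : sigmaProp K N) (f : N →ₗ[A] N') (hf : Function.Surjective f) : sigmaProp K N' := by
  obtain ⟨I, X, p, i, hp, hi⟩ := hN
  let S := (LinearMap.ker f).map i
  let g : (N ⧸ LinearMap.ker f) →ₗ[A] X ⧸ S :=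
    (LinearMap.ker f).mapQ S i (Submodule.le_comap_map _ _)
  refine ⟨I, ModuleCat.of A (X ⧸ S), S.mkQ ∘ₗ p,
    g ∘ₗ (f.quotKerEquivOfSurjective hf).symm.toLinearMap, S.mkQ_surjective.comp hp, ?_⟩
  rw [LinearMap.coe_comp]
  refine Function.Injective.comp ?_ (f.quotKerEquivOfSurjective hf).symm.injective
  rw [← LinearMap.ker_eq_bot, Submodule.ker_mapQ, Submodule.comap_map_eq_of_injective hi]
  simp

theorem sigmaProp_sigmaTrace (K M : ModuleCat.{u} A) :
    sigmaProp K (ModuleCat.of A (sigmaTrace K M)) := by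
  classical
  let J := {U : Submodule A M // sigmaProp K (ModuleCat.of A U)}
  have hS : sigmaTrace K M = ⨆ j : J, j.1 := by
    apply le_antisymm
    · refine iSup_le fun N => iSup_le fun hN => iSup_le fun f => ?_
      exact le_iSup (fun j : J => j.1) ⟨LinearMap.range f,
        sigmaProp_of_surjective K (N' := ModuleCat.of A (LinearMap.range f)) hN f.rangeRestrict
          f.surjective_rangeRestrict⟩
    · refine iSup_le fun j => ?_
      refine le_trans (le_of_eq ?_) (le_iSup_of_le (ModuleCat.of A j.1)
        (le_iSup_of_le j.2 (le_iSup_of_le j.1.subtype le_rfl)))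
      exact (Submodule.range_subtype _).symm
  choose I X p i hp hi using fun j : J => j.2
  let D := Π₀ j : J, j.1
  have hD : sigmaProp K (ModuleCat.of A D) := by
    refine ⟨Σ j, I j, ModuleCat.of A (Π₀ j, X j),
      (DFinsupp.mapRange.linearMap p) ∘ₗ (sigmaFinsuppLequivDFinsupp A).toLinearMap,
      DFinsupp.mapRange.linearMap i, ?_, ?_⟩
    · exact ((DFinsupp.mapRange_surjective _ fun j => map_zero (p j)).2 hp).comp
        (sigmaFinsuppLequivDFinsupp A).surjective
    · exact (DFinsupp.mapRange_injective _ fun j => map_zero (i j)).2 hi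
  have hr : LinearMap.range (DFinsupp.lsum ℕ fun j : J => j.1.subtype) = sigmaTrace K M := by
    rw [hS, Submodule.iSup_eq_range_dfinsupp_lsum]
  exact sigmaProp_of_surjective K hD
    ((LinearEquiv.ofEq _ _ hr).toLinearMap ∘ₗ LinearMap.rangeRestrict _)
    ((LinearEquiv.ofEq _ _ hr).surjective.comp (LinearMap.surjective_rangeRestrict _))

theorem map_mem_sigmaTrace (K : ModuleCat.{u} A) {M N : ModuleCat.{u} A} (f : M →ₗ[A] N) {m : M}
    (hm : m ∈ sigmaTrace K M) : f m ∈ sigmaTrace K N := by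
  have h : sigmaTrace K M ≤ (sigmaTrace K N).comap f := by
    refine iSup_le fun L => iSup_le fun hL => iSup_le fun g => ?_
    rintro _ ⟨x, rfl⟩
    exact le_iSup_of_le (f := fun L => ⨆ (_ : sigmaProp K L) (f : L →ₗ[A] N), LinearMap.range f) L
      (le_iSup_of_le hL (le_iSup_of_le (f ∘ₗ g) le_rfl)) ⟨x, rfl⟩
  exact h hm

/-- The functor `Sp(σ[_A K], -) : _A M → σ[_A K]`. -/
def sigmaTraceFunctor (K : ModuleCat.{u} A) : ModuleCat.{u} A ⥤ SigmaCat K where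
  obj M := ⟨ModuleCat.of A (sigmaTrace K M), sigmaProp_sigmaTrace K M⟩
  map f := ObjectProperty.homMk <| ModuleCat.ofHom <|
    f.hom.restrict fun _ hm => map_mem_sigmaTrace K f.hom hm

/-- The general coinduction functor
`Coind_K^L = Sp(σ[_B L], Hom_A(B, -)) : σ[_A K] → σ[_B L]` along a ring morphism `ξ : A → B`. -/
def generalCoind (ξ : A →+* B) (K : ModuleCat.{u} A) (L : ModuleCat.{u} B) :
    SigmaCat K ⥤ SigmaCat L :=
  (sigmaProp K).ι ⋙ ModuleCat.coextendScalars.{u, u, u} ξ ⋙ sigmaTraceFunctor L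

end Subgenerated

section Cotensor

variable {R C D : Type u} [CommRing R] [AddCommGroup C] [Module R C] [Coalgebra R C]
  [AddCommGroup D] [Module R D] [Coalgebra R D]

/-- The map `id ⊗ Δ_D : M ⊗ D → (M ⊗ D) ⊗ D`. -/
def freeCoact (M D : Type u) [AddCommGroup M] [Module R M] [AddCommGroup D] [Module R D]
    [Coalgebra R D] : M ⊗[R] D →ₗ[R] (M ⊗[R] D) ⊗[R] D :=
  (TensorProduct.assoc R M D D).symm.toLinearMap ∘ₗ Coalgebra.comul.lTensor M

theorem isRightCoaction_freeCoact (M : Type u) [AddCommGroup M] [Module R M] :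
    IsRightCoaction (freeCoact (R := R) M D) where
  coassoc := by
    ext m d
    have key1 : ∀ z : D ⊗[R] D, TensorProduct.assoc R (M ⊗[R] D) D D
        ((freeCoact M D).rTensor D ((TensorProduct.assoc R M D D).symm (m ⊗ₜ z))) =
        (TensorProduct.assoc R M D (D ⊗[R] D)).symm
          (m ⊗ₜ (TensorProduct.assoc R D D D (Coalgebra.comul.rTensor D z))) := by
      intro z
      induction z with
      | zero => simp
      | add x y hx hy => simp only [map_add, TensorProduct.tmul_add, hx, hy]
      | tmul x y =>
        simp only [TensorProduct.assoc_symm_tmul, LinearMap.rTensor_tmul, freeCoact,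
          LinearMap.comp_apply, LinearEquiv.coe_coe, LinearMap.lTensor_tmul]
        generalize (Coalgebra.comul (R := R) x) = w
        induction w with
        | zero => simp
        | add x y hx hy => simp only [map_add, TensorProduct.tmul_add, TensorProduct.add_tmul,
            hx, hy]
        | tmul x y => simp
    have key2 : ∀ z : D ⊗[R] D, Coalgebra.comul.lTensor (M ⊗[R] D)
        ((TensorProduct.assoc R M D D).symm (m ⊗ₜ z)) =
        (TensorProduct.assoc R M D (D ⊗[R] D)).symm (m ⊗ₜ (Coalgebra.comul.lTensor D z)) := by
      intro z
      induction z with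
      | zero => simp
      | add x y hx hy => simp only [map_add, TensorProduct.tmul_add, hx, hy]
      | tmul x y => simp
    have h := Coalgebra.coassoc_apply (R := R) d
    have e : freeCoact M D (m ⊗ₜ[R] d) =
      (TensorProduct.assoc R M D D).symm (m ⊗ₜ Coalgebra.comul d) := rfl
    simp only [TensorProduct.AlgebraTensorModule.curry_apply, TensorProduct.curry_apply,
      LinearMap.coe_restrictScalars, LinearMap.comp_apply, LinearEquiv.coe_coe]
    rw [e, key1, key2, h]
  counit := by
    ext m d
    have key : ∀ z : D ⊗[R] D, TensorProduct.rid R (M ⊗[R] D) (Coalgebra.counit.lTensor (M ⊗[R] D)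
        ((TensorProduct.assoc R M D D).symm (m ⊗ₜ z))) =
        m ⊗ₜ (TensorProduct.rid R D (Coalgebra.counit.lTensor D z)) := by
      intro z
      induction z with
      | zero => simp
      | add x y hx hy => simp only [map_add, TensorProduct.tmul_add, hx, hy]
      | tmul x y => simp
    have e : freeCoact M D (m ⊗ₜ[R] d) =
      (TensorProduct.assoc R M D D).symm (m ⊗ₜ Coalgebra.comul d) := rfl
    simp only [TensorProduct.AlgebraTensorModule.curry_apply, TensorProduct.curry_apply,
      LinearMap.coe_restrictScalars, LinearMap.comp_apply, LinearEquiv.coe_coe]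
    rw [e, key]
    simp

theorem leftCoactOfHom_colinear (θ : D →ₗc[R] C) (d : D) :
    (leftCoactOfHom θ).rTensor D (Coalgebra.comul (R := R) d) =
      (TensorProduct.assoc R C D D).symm (Coalgebra.comul.lTensor C (leftCoactOfHom θ d)) := by
  have h := Coalgebra.coassoc_symm_apply (R := R) d
  have key1 : ∀ z : D ⊗[R] D, (TensorProduct.assoc R C D D).symm (Coalgebra.comul.lTensor C
      (θ.toLinearMap.rTensor D z)) = (θ.toLinearMap.rTensor D).rTensor D
        ((TensorProduct.assoc R D D D).symm (Coalgebra.comul.lTensor D z)) := by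
    intro z
    induction z with
    | zero => simp
    | add x y hx hy => simp only [map_add, hx, hy]
    | tmul x y =>
      simp only [LinearMap.rTensor_tmul, LinearMap.lTensor_tmul]
      generalize (Coalgebra.comul (R := R) y) = w
      induction w with
      | zero => simp
      | add x y hx hy => simp only [map_add, TensorProduct.tmul_add, hx, hy]
      | tmul x y => simp
  rw [leftCoactOfHom, LinearMap.comp_apply, key1, h, LinearMap.rTensor_comp]
  rfl

/-- A subspace that is stable under a coaction of a flat coalgebra is a subcomodule. -/
theorem isRightCoaction_of_injective [Module.Flat R D] {K X : Type u} [AddCommGroup K] [Module R K]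
    [AddCommGroup X] [Module R X] (ω : X →ₗ[R] X ⊗[R] D) (hω : IsRightCoaction ω) (i : K →ₗ[R] X)
    (hi : Function.Injective i) (κ : K →ₗ[R] K ⊗[R] D) (h : i.rTensor D ∘ₗ κ = ω ∘ₗ i) :
    IsRightCoaction κ where
  coassoc := by
    have hinj : Function.Injective (i.rTensor (D ⊗[R] D)) :=
      Module.Flat.rTensor_preserves_injective_linearMap i hi
    refine LinearMap.ext fun x => hinj ?_
    have h1 : ∀ z : (K ⊗[R] D) ⊗[R] D, i.rTensor (D ⊗[R] D) (TensorProduct.assoc R K D D z) =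
        TensorProduct.assoc R X D D ((i.rTensor D).rTensor D z) := by
      intro z
      have : i.rTensor (D ⊗[R] D) ∘ₗ (TensorProduct.assoc R K D D).toLinearMap =
          (TensorProduct.assoc R X D D).toLinearMap ∘ₗ (i.rTensor D).rTensor D := by
        ext; simp
      exact LinearMap.congr_fun this z
    have h2 : ∀ z : K ⊗[R] D, i.rTensor (D ⊗[R] D) (Coalgebra.comul.lTensor K z) =
        Coalgebra.comul.lTensor X (i.rTensor D z) := by
      intro z
      induction z with
      | zero => simp
      | add x y hx hy => simp only [map_add, hx, hy]
      | tmul x y => simp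
    have h3 : ∀ z : K ⊗[R] D, (i.rTensor D).rTensor D (κ.rTensor D z) =
        ω.rTensor D (i.rTensor D z) := by
      intro z
      rw [← LinearMap.comp_apply, ← LinearMap.rTensor_comp, h, LinearMap.rTensor_comp]
      rfl
    have h4 := LinearMap.congr_fun h x
    have h5 := LinearMap.congr_fun hω.coassoc (i x)
    simp only [LinearMap.comp_apply, LinearEquiv.coe_coe] at h4 h5 ⊢
    rw [h1, h3, h4, h5, h2, h4]
  counit := by
    refine LinearMap.ext fun x => hi ?_
    have h2 : ∀ z : K ⊗[R] D, i (TensorProduct.rid R K (Coalgebra.counit.lTensor K z)) =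
        TensorProduct.rid R X (Coalgebra.counit.lTensor X (i.rTensor D z)) := by
      intro z
      induction z with
      | zero => simp
      | add x y hx hy => simp only [map_add, hx, hy]
      | tmul x y => simp
    have h4 := LinearMap.congr_fun h x
    have h5 := LinearMap.congr_fun hω.counit (i x)
    simp only [LinearMap.comp_apply, LinearEquiv.coe_coe, LinearMap.id_apply] at h4 h5 ⊢
    rw [h2, h4, h5]

section

variable {M : Type u} [AddCommGroup M] [Module R M] (ρ : M →ₗ[R] M ⊗[R] C) (θ : D →ₗc[R] C)

theorem freeCoact_mem_range [Module.Flat R D] (t : cotensor ρ (leftCoactOfHom θ)) :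
    freeCoact M D t.1 ∈
      LinearMap.range ((cotensor ρ (leftCoactOfHom θ)).subtype.rTensor D) := by
  set δ : M ⊗[R] D →ₗ[R] M ⊗[R] (C ⊗[R] D) :=
    (TensorProduct.assoc R M C D).toLinearMap ∘ₗ ρ.rTensor D - (leftCoactOfHom θ).lTensor M with hδ
  have hex : Function.Exact ((cotensor ρ (leftCoactOfHom θ)).subtype.rTensor D) (δ.rTensor D) :=
    Module.Flat.rTensor_exact D (LinearMap.exact_subtype_ker_map δ)
  refine (hex _).1 ?_
  have key : δ.rTensor D ∘ₗ freeCoact M D = ((TensorProduct.assoc R M (C ⊗[R] D) D).symm.toLinearMap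
      ∘ₗ ((TensorProduct.assoc R C D D).symm.toLinearMap ∘ₗ
        Coalgebra.comul.lTensor C).lTensor M) ∘ₗ δ := by
    ext m d
    simp only [hδ, TensorProduct.AlgebraTensorModule.curry_apply, TensorProduct.curry_apply,
      LinearMap.coe_restrictScalars, LinearMap.comp_apply, LinearEquiv.coe_coe,
      LinearMap.sub_apply, LinearMap.rTensor_sub, map_sub, LinearMap.lTensor_tmul]
    rw [← leftCoactOfHom_colinear]
    simp only [freeCoact, LinearMap.comp_apply, LinearMap.lTensor_tmul, LinearMap.rTensor_tmul,
      LinearEquiv.coe_coe]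
    congr 1
    · have k1 : ∀ z : D ⊗[R] D,
          ((TensorProduct.assoc R M C D).toLinearMap ∘ₗ ρ.rTensor D).rTensor D
            ((TensorProduct.assoc R M D D).symm (m ⊗ₜ z)) =
          (TensorProduct.assoc R M C D).toLinearMap.rTensor D
            ((TensorProduct.assoc R (M ⊗[R] C) D D).symm (ρ m ⊗ₜ z)) := by
        intro z
        induction z with
        | zero => simp
        | add x y hx hy => simp only [map_add, TensorProduct.tmul_add, hx, hy]
        | tmul x y => simp
      rw [k1]
      generalize ρ m = x
      induction x with
      | zero => simp
      | add x y hx hy => simp only [map_add, TensorProduct.add_tmul, hx, hy]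
      | tmul x c =>
        simp only [TensorProduct.assoc_tmul, LinearMap.lTensor_tmul, LinearMap.comp_apply,
          LinearEquiv.coe_coe]
        generalize (Coalgebra.comul (R := R) d) = z
        induction z with
        | zero => simp
        | add x y hx hy => simp only [map_add, TensorProduct.tmul_add, hx, hy]
        | tmul x y => simp
    · generalize (Coalgebra.comul (R := R) d) = z
      induction z with
      | zero => simp
      | add x y hx hy => simp only [map_add, TensorProduct.tmul_add, hx, hy]
      | tmul x y => simp
  have ht : δ t.1 = 0 := t.2
  rw [← LinearMap.comp_apply, key, LinearMap.comp_apply, ht, map_zero]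

/-- The right `D`-comodule structure of `M □_C D`: the restriction of `id ⊗ Δ_D`. -/
def cotensorCoact [Module.Flat R D] :
    cotensor ρ (leftCoactOfHom θ) →ₗ[R] cotensor ρ (leftCoactOfHom θ) ⊗[R] D :=
  (LinearEquiv.ofInjective _ (Module.Flat.rTensor_preserves_injective_linearMap (M := D) _
    (cotensor ρ (leftCoactOfHom θ)).injective_subtype)).symm.toLinearMap ∘ₗ
      (freeCoact M D ∘ₗ (cotensor ρ (leftCoactOfHom θ)).subtype).codRestrict _
        (freeCoact_mem_range ρ θ)

theorem rTensor_cotensorCoact [Module.Flat R D] :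
    (cotensor ρ (leftCoactOfHom θ)).subtype.rTensor D ∘ₗ cotensorCoact ρ θ =
      freeCoact M D ∘ₗ (cotensor ρ (leftCoactOfHom θ)).subtype := by
  ext t : 1
  have h := LinearEquiv.apply_symm_apply (LinearEquiv.ofInjective _
    (Module.Flat.rTensor_preserves_injective_linearMap (M := D) _
      (cotensor ρ (leftCoactOfHom θ)).injective_subtype))
    ((freeCoact M D ∘ₗ (cotensor ρ (leftCoactOfHom θ)).subtype).codRestrict _
        (freeCoact_mem_range ρ θ) t)
  exact congrArg Subtype.val h

theorem isRightCoaction_cotensorCoact [Module.Flat R D] : IsRightCoaction (cotensorCoact ρ θ) :=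
  isRightCoaction_of_injective _ (isRightCoaction_freeCoact M) _
    (cotensor ρ (leftCoactOfHom θ)).injective_subtype _ (rTensor_cotensorCoact ρ θ)

end

theorem rTensor_mem_cotensor (θ : D →ₗc[R] C) {M N : RightComodule R C} (f : M ⟶ N)
    {t : M.carrier ⊗[R] D} (ht : t ∈ cotensor M.coact (leftCoactOfHom θ)) :
    (RightComodule.Hom.toLin f).rTensor D t ∈ cotensor N.coact (leftCoactOfHom θ) := by
  set g := RightComodule.Hom.toLin f
  have hg : N.coact ∘ₗ g = g.rTensor C ∘ₗ M.coact := RightComodule.Hom.colinear f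
  have h1 : (TensorProduct.assoc R N.carrier C D).toLinearMap ∘ₗ (g.rTensor C).rTensor D =
      g.rTensor (C ⊗[R] D) ∘ₗ (TensorProduct.assoc R M.carrier C D).toLinearMap := by
    ext; simp
  have h2 : (leftCoactOfHom θ).lTensor N.carrier ∘ₗ g.rTensor D =
      g.rTensor (C ⊗[R] D) ∘ₗ (leftCoactOfHom θ).lTensor M.carrier := by
    ext; simp
  have key : ((TensorProduct.assoc R N.carrier C D).toLinearMap ∘ₗ N.coact.rTensor D -
      (leftCoactOfHom θ).lTensor N.carrier) ∘ₗ g.rTensor D =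
      g.rTensor (C ⊗[R] D) ∘ₗ ((TensorProduct.assoc R M.carrier C D).toLinearMap ∘ₗ
        M.coact.rTensor D - (leftCoactOfHom θ).lTensor M.carrier) := by
    rw [LinearMap.sub_comp, LinearMap.comp_sub, h2, LinearMap.comp_assoc, ← LinearMap.rTensor_comp,
      hg, LinearMap.rTensor_comp, ← LinearMap.comp_assoc, h1, LinearMap.comp_assoc]
  have h := LinearMap.congr_fun key t
  have ht' : ((TensorProduct.assoc R M.carrier C D).toLinearMap ∘ₗ
        M.coact.rTensor D - (leftCoactOfHom θ).lTensor M.carrier) t = 0 := ht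
  rw [LinearMap.comp_apply, LinearMap.comp_apply, ht', map_zero] at h
  exact h

/-- The ad-corestriction functor `- □_C D : M^C → M^D` of a coalgebra morphism `θ : D → C` with
`D` flat over `R`. -/
def adCorestriction [Module.Flat R D] (θ : D →ₗc[R] C) : RightComodule R C ⥤ RightComodule R D where
  obj M :=
    { carrier := cotensor M.coact (leftCoactOfHom θ)
      coact := cotensorCoact M.coact θ
      isCoaction := isRightCoaction_cotensorCoact M.coact θ }
  map {M N} f :=
    { toLin := ((RightComodule.Hom.toLin f).rTensor D).restrict
        fun _ ht => rTensor_mem_cotensor θ f ht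
      colinear := by
        set g := RightComodule.Hom.toLin f
        set gK := (g.rTensor D).restrict fun _ ht => rTensor_mem_cotensor θ f ht
        have hinj : Function.Injective
            ((cotensor N.coact (leftCoactOfHom θ)).subtype.rTensor D) :=
          Module.Flat.rTensor_preserves_injective_linearMap _
            (cotensor N.coact (leftCoactOfHom θ)).injective_subtype
        have hs : (cotensor N.coact (leftCoactOfHom θ)).subtype ∘ₗ gK =
            g.rTensor D ∘ₗ (cotensor M.coact (leftCoactOfHom θ)).subtype := rfl
        have hfree : freeCoact N.carrier D ∘ₗ g.rTensor D =
            (g.rTensor D).rTensor D ∘ₗ freeCoact M.carrier D := by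
          ext m d
          simp only [freeCoact, TensorProduct.AlgebraTensorModule.curry_apply,
            TensorProduct.curry_apply, LinearMap.coe_restrictScalars, LinearMap.comp_apply,
            LinearMap.rTensor_tmul, LinearMap.lTensor_tmul, LinearEquiv.coe_coe]
          generalize (Coalgebra.comul (R := R) d) = z
          induction z with
          | zero => simp
          | add x y hx hy => simp only [map_add, TensorProduct.tmul_add, hx, hy]
          | tmul x y => simp
        rw [← LinearMap.cancel_left hinj, ← LinearMap.comp_assoc, rTensor_cotensorCoact,
          LinearMap.comp_assoc, hs, ← LinearMap.comp_assoc, hfree, ← LinearMap.comp_assoc,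
          ← LinearMap.rTensor_comp, hs, LinearMap.rTensor_comp, LinearMap.comp_assoc,
          LinearMap.comp_assoc, rTensor_cotensorCoact] }
  map_id M := by
    apply RightComodule.hom_ext
    refine LinearMap.ext fun t => Subtype.ext ?_
    change (LinearMap.id.rTensor D) t.1 = t.1
    simp
  map_comp {M N L} f g := by
    apply RightComodule.hom_ext
    refine LinearMap.ext fun t => Subtype.ext ?_
    change ((RightComodule.Hom.toLin g ∘ₗ RightComodule.Hom.toLin f).rTensor D) t.1 = _
    rw [LinearMap.rTensor_comp]
    rfl

end Cotensor

section EnvelopingHom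

variable {R A B C D : Type u} [CommRing R] [Ring A] [Algebra R A] [Ring B] [Algebra R B]
  [AddCommGroup C] [Module R C] [Coalgebra R C] [AddCommGroup D] [Module R D] [Coalgebra R D]
  {P : MeasuringPairing R A C} {Q : MeasuringPairing R B D}

namespace MeasuringPairing

/-- The module `M ⊗_R D`, for a left `A`-module `M` and a morphism of measuring pairings
`φ : (B, D) → (A, C)`, with the structures of an `A^e`-module and of a left `B`-module below. -/
def EnvTensor (_ : Q.Hom P) (M : Type u) [AddCommGroup M] [Module R M] : Type u := M ⊗[R] D

variable (φ : Q.Hom P) (M : Type u) [AddCommGroup M] [Module R M]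

instance : AddCommGroup (EnvTensor φ M) := inferInstanceAs (AddCommGroup (M ⊗[R] D))

instance : Module R (EnvTensor φ M) := inferInstanceAs (Module R (M ⊗[R] D))

/-- The left `A^e`-action on `M ⊗ D`, where `D` is a left `C`-comodule through `θ`, hence a right
`A`-module: `(a ⊗ a') (m ⊗ d) = a m ⊗ d a'`. -/
def envAct [Module A M] [IsScalarTower R A M] :
    A ⊗[R] Aᵐᵒᵖ →ₐ[R] Module.End R (M ⊗[R] D) :=
  Module.endTensorEndAlgHom.comp (Algebra.TensorProduct.map (Algebra.lsmul R R M)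
    (P.rightAct (leftCoactOfHom φ.θ) (isLeftCoaction_leftCoactOfHom φ.θ)))

theorem envAct_tmul [Module A M] [IsScalarTower R A M] (a : A) (a' : Aᵐᵒᵖ) (m : M) (d : D) :
    envAct φ M (a ⊗ₜ a') (m ⊗ₜ d) = (a • m) ⊗ₜ
      P.rightAct (leftCoactOfHom φ.θ) (isLeftCoaction_leftCoactOfHom φ.θ) a' d := rfl

instance [Module A M] [IsScalarTower R A M] : Module (A ⊗[R] Aᵐᵒᵖ) (EnvTensor φ M) :=
  Module.compHom (M ⊗[R] D) (envAct φ M).toRingHom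

/-- The left `B`-module structure of `M ⊗ D` that belongs to the right `D`-comodule structure
`id ⊗ Δ_D`, that is `b (m ⊗ d) = m ⊗ (b ⇀ d)`. -/
instance : Module B (EnvTensor φ M) :=
  Module.compHom (M ⊗[R] D)
    (Q.leftAct (freeCoact M D) (isRightCoaction_freeCoact M)).toRingHom

theorem leftAct_freeCoact_tmul (b : B) (m : M) (d : D) :
    Q.leftAct (freeCoact M D) (isRightCoaction_freeCoact M) b (m ⊗ₜ d) =
      m ⊗ₜ Q.leftAct Coalgebra.comul isRightCoaction_comul b d := by
  simp only [leftAct_apply, freeCoact, LinearMap.comp_apply, LinearMap.lTensor_tmul,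
    LinearEquiv.coe_coe]
  generalize (Coalgebra.comul (R := R) d) = z
  induction z with
  | zero => simp
  | add x y hx hy => simp only [map_add, LinearMap.add_apply, TensorProduct.tmul_add, hx, hy]
  | tmul x y => simp

instance : IsScalarTower R B (EnvTensor φ M) :=
  ⟨fun r b t => by
    change Q.leftAct (freeCoact M D) (isRightCoaction_freeCoact M) (r • b) t =
      r • Q.leftAct (freeCoact M D) (isRightCoaction_freeCoact M) b t
    rw [map_smul]
    rfl⟩

theorem isRational_envTensor : Q.IsRational (EnvTensor φ M) :=
  (Q.isRational_iff _).2 fun t => ⟨freeCoact M D t, fun _ => rfl⟩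

/-- The two actions of a bicomodule commute: `b ⇀ (d ↼ a) = (b ⇀ d) ↼ a`. -/
theorem leftAct_rightAct (a : Aᵐᵒᵖ) (b : B) (d : D) :
    Q.leftAct Coalgebra.comul isRightCoaction_comul b
      (P.rightAct (leftCoactOfHom φ.θ) (isLeftCoaction_leftCoactOfHom φ.θ) a d) =
    P.rightAct (leftCoactOfHom φ.θ) (isLeftCoaction_leftCoactOfHom φ.θ) a
      (Q.leftAct Coalgebra.comul isRightCoaction_comul b d) := by
  obtain ⟨a, rfl⟩ := MulOpposite.op_surjective a
  set F : C ⊗[R] D →ₗ[R] D := (pairingAlpha P.form D ∘ₗ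
    (TensorProduct.comm R C D).toLinearMap).flip a with hF
  have hF1 : ∀ c d, F (c ⊗ₜ d) = P.form a c • d := fun _ _ => rfl
  have hr : ∀ x : D, P.rightAct (leftCoactOfHom φ.θ) (isLeftCoaction_leftCoactOfHom φ.θ)
      (MulOpposite.op a) x = F (leftCoactOfHom φ.θ x) := fun _ => rfl
  have h1 : ∀ z : C ⊗[R] D, Q.leftAct Coalgebra.comul isRightCoaction_comul b (F z) =
      pairingAlpha Q.form D (F.rTensor D
        ((TensorProduct.assoc R C D D).symm (Coalgebra.comul.lTensor C z))) b := by
    intro z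
    induction z with
    | zero => simp
    | add x y hx hy => simp only [map_add, LinearMap.add_apply, hx, hy]
    | tmul c x =>
      rw [hF1, map_smul, leftAct_apply, LinearMap.lTensor_tmul]
      generalize (Coalgebra.comul (R := R) x) = w
      induction w with
      | zero => simp
      | add x y hx hy => simp only [map_add, LinearMap.add_apply, TensorProduct.tmul_add,
          smul_add, hx, hy]
      | tmul x y => simp [hF1, smul_smul, mul_comm]
  rw [hr, hr, h1, ← leftCoactOfHom_colinear, pairingAlpha_rTensor, pairingAlpha_rTensor,
    leftAct_apply]

instance [Module A M] [IsScalarTower R A M] : SMulCommClass (A ⊗[R] Aᵐᵒᵖ) B (EnvTensor φ M) :=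
  ⟨fun s b t => by
    change envAct φ M s (Q.leftAct (freeCoact M D) (isRightCoaction_freeCoact M) b t) =
      Q.leftAct (freeCoact M D) (isRightCoaction_freeCoact M) b (envAct φ M s t)
    change M ⊗[R] D at t
    induction s with
    | zero => simp
    | add x y hx hy => simp only [map_add, LinearMap.add_apply, hx, hy]
    | tmul a a' =>
      induction t with
      | zero => simp
      | add x y hx hy => simp only [map_add, hx, hy]
      | tmul m d =>
        rw [leftAct_freeCoact_tmul, envAct_tmul, envAct_tmul, leftAct_freeCoact_tmul,
          leftAct_rightAct]⟩

attribute [local instance] instModuleTensorProductMop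

/-- `Hom_{A^e}(A, M ⊗_R D)`, a left `B`-module through the action of `B` on `M ⊗_R D`. -/
abbrev EnvHom [Module A M] [IsScalarTower R A M] : Type u :=
  A →ₗ[A ⊗[R] Aᵐᵒᵖ] EnvTensor φ M

variable {M}

/-- An `A`-linear map `g : M → N` induces the `A^e`-linear map `g ⊗ id : M ⊗ D → N ⊗ D`. -/
def envTensorMap {N : Type u} [AddCommGroup N] [Module R N] [Module A M] [IsScalarTower R A M]
    [Module A N] [IsScalarTower R A N] (g : M →ₗ[A] N) :
    EnvTensor φ M →ₗ[A ⊗[R] Aᵐᵒᵖ] EnvTensor φ N where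
  toFun := (g.restrictScalars R).rTensor D
  map_add' := map_add ((g.restrictScalars R).rTensor D)
  map_smul' s t := by
    change (g.restrictScalars R).rTensor D (envAct φ M s t) =
      envAct φ N s ((g.restrictScalars R).rTensor D t)
    change M ⊗[R] D at t
    induction s with
    | zero => simp
    | add x y hx hy => simp only [map_add, LinearMap.add_apply, hx, hy]
    | tmul a a' =>
      induction t with
      | zero => simp
      | add x y hx hy => simp only [map_add, hx, hy]
      | tmul m d => simp [envAct_tmul]

theorem envTensorMap_smul {N : Type u} [AddCommGroup N] [Module R N] [Module A M]
    [IsScalarTower R A M] [Module A N] [IsScalarTower R A N] (g : M →ₗ[A] N) (b : B)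
    (t : EnvTensor φ M) : envTensorMap φ g (b • t) = b • envTensorMap φ g t := by
  change (g.restrictScalars R).rTensor D
      (Q.leftAct (freeCoact M D) (isRightCoaction_freeCoact M) b t) =
    Q.leftAct (freeCoact N D) (isRightCoaction_freeCoact N) b ((g.restrictScalars R).rTensor D t)
  change M ⊗[R] D at t
  induction t with
  | zero => simp
  | add x y hx hy => simp only [map_add, hx, hy]
  | tmul m d => rw [leftAct_freeCoact_tmul, LinearMap.rTensor_tmul, LinearMap.rTensor_tmul,
      leftAct_freeCoact_tmul]

variable (M) in
/-- Evaluation at `1`, as a `B`-linear map `Hom_{A^e}(A, M ⊗ D) → M ⊗ D`. -/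
def envHomEval [Module A M] [IsScalarTower R A M] : EnvHom φ M →ₗ[B] EnvTensor φ M where
  toFun f := f 1
  map_add' _ _ := rfl
  map_smul' _ _ := rfl

theorem envHomEval_injective [Module A M] [IsScalarTower R A M] :
    Function.Injective (envHomEval φ M) := by
  intro f g h
  refine LinearMap.ext fun a => ?_
  have h1 : (a ⊗ₜ[R] (1 : Aᵐᵒᵖ)) • (1 : A) = a := by
    change TensorProduct.Algebra.moduleAux _ _ = _
    simp [TensorProduct.Algebra.moduleAux]
  have h2 : f 1 = g 1 := h
  rw [← h1, map_smul, map_smul, h2]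

end MeasuringPairing

end EnvelopingHom

section Functors

variable {R A B C D : Type u} [CommRing R] [Ring A] [Algebra R A] [Ring B] [Algebra R B]
  [AddCommGroup C] [Module R C] [Coalgebra R C] [AddCommGroup D] [Module R D] [Coalgebra R D]

attribute [local instance] baseModule baseModule_isScalarTower

open MeasuringPairing in
theorem MeasuringAlphaPairing.ratProp_envHom {P : MeasuringPairing R A C}
    (Q : MeasuringAlphaPairing R B D) (φ : Q.Hom P) (M : Type u) [AddCommGroup M] [Module R M]
    [Module A M] [IsScalarTower R A M] : Q.ratProp (ModuleCat.of B (EnvHom φ M)) := by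
  let _ : Module R (EnvHom φ M) := Module.restrictScalars R B _
  have : IsScalarTower R B (EnvHom φ M) := IsScalarTower.restrictScalars R B _
  refine Q.ratProp_of (Submodule.eq_top_iff'.2 fun f => ?_)
  refine Q.mem_ratSubmodule_of_injective (envHomEval φ M) (envHomEval_injective φ) f ?_
  rw [isRational_envTensor φ M]
  trivial

variable {P : MeasuringAlphaPairing R A C} {Q : MeasuringAlphaPairing R B D}
  (φ : Q.Hom P.toMeasuringPairing)

open MeasuringPairing in
attribute [local instance] instModuleTensorProductMop in
/-- The functor `Hom_{A^e}(A, - ⊗_R D) : Rat^C(_A M) → Rat^D(_B M)`. -/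
def envHomFunctor : P.RatCat ⥤ Q.RatCat where
  obj M := ⟨ModuleCat.of B (EnvHom φ M.obj), Q.ratProp_envHom φ M.obj⟩
  map g := ObjectProperty.homMk <| ModuleCat.ofHom
    { toFun := fun f => envTensorMap φ g.hom.hom ∘ₗ f
      map_add' := fun _ _ => LinearMap.comp_add _ _ _
      map_smul' := fun b f => LinearMap.ext fun a => envTensorMap_smul φ g.hom.hom b (f a) }
  map_id M := by
    apply ObjectProperty.hom_ext
    apply ModuleCat.hom_ext
    refine LinearMap.ext fun f => LinearMap.ext fun a => ?_
    exact LinearMap.congr_fun (LinearMap.rTensor_id D M.obj) (f a)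
  map_comp {M N L} g h := by
    apply ObjectProperty.hom_ext
    apply ModuleCat.hom_ext
    refine LinearMap.ext fun f => LinearMap.ext fun a => ?_
    change ((h.hom.hom.restrictScalars R ∘ₗ g.hom.hom.restrictScalars R).rTensor D) (f a) = _
    rw [LinearMap.rTensor_comp]
    rfl

/-- The coinduction functor `Coind_P^Q = Rat^D(Hom_A(B, -)) : Rat^C(_A M) → Rat^D(_B M)`. -/
def coind : P.RatCat ⥤ Q.RatCat :=
  P.ratProp.ι ⋙ ModuleCat.coextendScalars.{u, u, u} φ.ξ.toRingHom ⋙ Q.ratFunctor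

/-- The ad-corestriction functor of the coalgebra morphism `θ : D → C` underlying a morphism
of measuring `α`-pairings; `D` is flat by the `α`-condition. -/
def cotensorFunctor : RightComodule R C ⥤ RightComodule R D :=
  haveI : Module.Flat R D := Q.alpha.flat
  adCorestriction φ.θ

/-- The general coinduction functor `Coind_C^D : σ[_A C] → σ[_B D]`. -/
def sigmaCoind : SigmaCat P.leftModule ⥤ SigmaCat Q.leftModule :=
  generalCoind φ.ξ.toRingHom P.leftModule Q.leftModule

end Functors

end

/-! The α-condition says that an element t of M ⊗ C is the same thing as a function A → M of a
special kind, and all statements are proved by testing tensors as functions.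

A coaction on M corresponds to representing each orbit map a ↦ a m by a tensor. If M is rational,
that tensor is unique, so it depends linearly on m; coassociativity and counit become (ab)m = a(bm)
and 1m = m after applying α (`isRightCoaction_ratCoact`). This inverts `toRat` on objects, and
colinearity and A-linearity are the same equation read through α. A rational N embeds by its
coaction into N ⊗ C, a quotient of a direct sum of copies of C, while rational modules are closed
under direct sums, quotients and, by α, submodules; hence `ratProp_eq_sigmaProp`.

For the functors, the common object is the set of central elements of M ⊗ D: those t with a t = t a
for all a in A, where A acts on D from the right through θ (`IsCentral`). Evaluation at 1 identifies
Hom over A^e from A to M ⊗ D with the central elements, because A is generated by 1 as a bimodule.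
Pairing the last C-leg with A turns the two maps that define M □_C D into t ↦ a t and t ↦ t a, so α
for P identifies the cotensor product with the central elements. Finally, α for Q sends t to a
function B → M; right multiplication of t by a becomes left multiplication of the argument by ξ(a),
so central elements are exactly the t whose function is A-linear, and every rational element of
Hom_A(B, M) arises in this way (`exists_isCentral`). The functor with Sp agrees with the one with
Rat because the largest rational submodule is the trace of the rational modules
(`ratSubmodule_eq_sigmaTrace`). -/

noncomputable section

/-! ### Closure properties of rational modules. -/

section RationalModules

variable {R A C : Type u} [CommRing R] [Ring A] [Algebra R A]
  [AddCommGroup C] [Module R C] [Coalgebra R C]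

/-- Two `R`-module structures compatible with the same `A`-module structure agree. -/
theorem module_ext_of_isScalarTower (R : Type u) {A : Type u} [CommRing R] [Ring A] [Algebra R A]
    {M : Type u} [AddCommGroup M] [Module A M] (i₁ i₂ : Module R M)
    (h₁ : @IsScalarTower R A M _ _ i₁.toSMul) (h₂ : @IsScalarTower R A M _ _ i₂.toSMul) :
    i₁ = i₂ := by
  refine Module.ext' _ _ fun r m => ?_
  have e₁ : algebraMap R A r • m = i₁.toSMul.smul r m :=
    letI := i₁
    algebraMap_smul A r m
  have e₂ : algebraMap R A r • m = i₂.toSMul.smul r m :=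
    letI := i₂
    algebraMap_smul A r m
  exact e₁.symm.trans e₂

namespace MeasuringPairing

variable (P : MeasuringPairing R A C)

/-- The identity ⟨a, b ⇀ c⟩ = ⟨ab, c⟩ on the second factor. It makes α_M linear over A when A acts
on functions by (bf)(x) = f(xb), which is the source of every linearity claim for maps into Hom_A(B,
M) and into N ⊗ C. -/
theorem pairingAlpha_leftAct_freeCoact {M : Type u} [AddCommGroup M] [Module R M] (t : M ⊗[R] C)
    (a b : A) :
    pairingAlpha P.form M (P.leftAct (freeCoact M C) (isRightCoaction_freeCoact M) b t) a =
      pairingAlpha P.form M t (a * b) := by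
  rw [← pairingAlpha_lTensor_leftAct]
  congr 2
  induction t with
  | zero => simp
  | add x y hx hy => simp only [map_add, hx, hy]
  | tmul m c => rw [leftAct_freeCoact_tmul, LinearMap.lTensor_tmul]

theorem isRational_of_surjective {M N : Type u} [AddCommGroup M] [Module R M] [Module A M]
    [IsScalarTower R A M] [AddCommGroup N] [Module R N] [Module A N] [IsScalarTower R A N]
    (f : M →ₗ[A] N) (hf : Function.Surjective f) (h : P.IsRational M) : P.IsRational N := by
  refine Submodule.eq_top_iff'.2 fun n => ?_
  obtain ⟨m, rfl⟩ := hf n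
  exact P.map_mem_ratSubmodule f (h ▸ Submodule.mem_top)

theorem isRational_finsupp {M : Type u} [AddCommGroup M] [Module R M] [Module A M]
    [IsScalarTower R A M] (I : Type u) (h : P.IsRational M) : P.IsRational (I →₀ M) := by
  refine Submodule.eq_top_iff'.2 fun x => ?_
  induction x using Finsupp.induction_linear with
  | zero => exact Submodule.zero_mem _
  | add x y hx hy => exact Submodule.add_mem _ hx hy
  | single i m =>
    exact P.map_mem_ratSubmodule (Finsupp.lsingle (R := A) (M := M) i) (h ▸ Submodule.mem_top)

end MeasuringPairing

namespace MeasuringAlphaPairing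

variable (P : MeasuringAlphaPairing R A C)

/-- The one closure property that needs the α-condition: quotients and direct sums of rational
modules are rational for any measuring pairing. -/
theorem isRational_of_injective {M N : Type u} [AddCommGroup M] [Module R M] [Module A M]
    [IsScalarTower R A M] [AddCommGroup N] [Module R N] [Module A N] [IsScalarTower R A N]
    (f : M →ₗ[A] N) (hf : Function.Injective f) (h : P.IsRational N) : P.IsRational M :=
  Submodule.eq_top_iff'.2 fun m =>
    P.mem_ratSubmodule_of_injective f hf m (h ▸ Submodule.mem_top)

/-! ### The comodule structure of a rational module and the isomorphism with comodules. -/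

section Coaction

variable {M : Type u} [AddCommGroup M] [Module R M] [Module A M] [IsScalarTower R A M]
  (h : P.IsRational M)

/-- The coaction of a rational module: `ρ(m)` is the unique element of `M ⊗ C` that represents
`a ↦ a m`. -/
def ratCoact : M →ₗ[R] M ⊗[R] C where
  toFun m := ((P.isRational_iff M).1 h m).choose
  map_add' m n := P.alpha M <| LinearMap.ext fun a => by
    rw [map_add, LinearMap.add_apply, ← ((P.isRational_iff M).1 h _).choose_spec a,
      ← ((P.isRational_iff M).1 h _).choose_spec a, ← ((P.isRational_iff M).1 h _).choose_spec a,
      smul_add]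
  map_smul' r m := P.alpha M <| LinearMap.ext fun a => by
    rw [map_smul, LinearMap.smul_apply, ← ((P.isRational_iff M).1 h _).choose_spec a,
      RingHom.id_apply, ← ((P.isRational_iff M).1 h _).choose_spec a, smul_algebra_smul_comm]

theorem pairingAlpha_ratCoact (m : M) (a : A) :
    pairingAlpha P.form M (P.ratCoact h m) a = a • m :=
  (((P.isRational_iff M).1 h m).choose_spec a).symm

/-- Applying α twice, for M ⊗ C and then for M, embeds (M ⊗ C) ⊗ C into functions of b and a. There
the two sides of coassociativity become a(bm) and (ab)m. The counit law is the value at 1. -/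
theorem isRightCoaction_ratCoact : IsRightCoaction (P.ratCoact h) where
  coassoc := by
    refine LinearMap.ext fun m => (TensorProduct.assoc R M C C).symm.injective <|
      P.alpha _ <| LinearMap.ext fun b => P.alpha _ <| LinearMap.ext fun a => ?_
    simp only [LinearMap.comp_apply, LinearEquiv.coe_coe, LinearEquiv.symm_apply_apply]
    rw [← P.pairingAlpha_mul, pairingAlpha_rTensor, pairingAlpha_ratCoact, pairingAlpha_ratCoact,
      pairingAlpha_ratCoact, mul_smul]
  counit := by
    refine LinearMap.ext fun m => ?_
    have h1 := P.pairingAlpha_one (P.ratCoact h m)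
    rw [pairingAlpha_ratCoact, one_smul] at h1
    exact h1.symm

end Coaction

attribute [local instance] baseModule baseModule_isScalarTower

/-- The right `C`-comodule that belongs to a `C`-rational module. -/
def ofRat (N : P.RatCat) : RightComodule R C where
  carrier := N.obj
  coact := P.ratCoact N.property
  isCoaction := P.isRightCoaction_ratCoact N.property

/-- An equality of objects, not only an isomorphism: the carrier and its addition are literally
unchanged, so only the two A-actions have to be compared, and they agree by the defining property of
the coaction. -/
theorem toRat_obj_ofRat (N : P.RatCat) : P.toRat.obj (P.ofRat N) = N := by
  have h : P.comoduleModule (P.ofRat N) = N.obj.isModule :=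
    Module.ext' _ _ fun a m => P.pairingAlpha_ratCoact N.property m a
  refine ObjectProperty.FullSubcategory.ext ?_
  exact congrArg (fun i : Module A N.obj => @ModuleCat.of A _ N.obj _ i) h

/-- The A-module determines everything in the comodule: the R-structure, since scalars act through
`algebraMap R A`, and the coaction, since α_M is injective. -/
theorem toRat_obj_injective : Function.Injective P.toRat.obj := by
  rintro ⟨M, ρ, hρ⟩ ⟨N, σ, hσ⟩ h
  rename_i iM jM iN jN
  have h1 := congrArg ObjectProperty.FullSubcategory.obj h
  have h3 : M = N := congrArg ModuleCat.carrier h1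
  -- The structures live over carriers that are only propositionally equal, so they are compared
  -- heterogeneously and eliminated in order of dependence: carrier, addition, R-action, coaction.
  have h4 : HEq iM iN := congr_arg_heq (fun X : ModuleCat A => X.isAddCommGroup) h1
  have h5 : HEq (P.comoduleModule (@RightComodule.mk R _ C _ _ _ M iM jM ρ hρ))
    (P.comoduleModule (@RightComodule.mk R _ C _ _ _ N iN jN σ hσ)) :=
    congr_arg_heq (fun X : ModuleCat A => X.isModule) h1
  subst h3
  obtain rfl := eq_of_heq h4
  have h7 : jM = jN := by
    let k := P.comoduleModule (@RightComodule.mk R _ C _ _ _ M iM jM ρ hρ)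
    refine module_ext_of_isScalarTower R (A := A) jM jN
      (P.comoduleModule_isScalarTower (@RightComodule.mk R _ C _ _ _ M iM jM ρ hρ)) ?_
    have := P.comoduleModule_isScalarTower (@RightComodule.mk R _ C _ _ _ M iM jN σ hσ)
    rwa [← show k = P.comoduleModule (@RightComodule.mk R _ C _ _ _ M iM jN σ hσ)
      from eq_of_heq h5] at this
  subst h7
  obtain rfl : ρ = σ := LinearMap.ext fun m => P.alpha M <| LinearMap.ext fun a =>
    congrArg (fun i : Module A M => i.toSMul.smul a m) (eq_of_heq h5)
  rfl

instance : P.toRat.Faithful where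
  map_injective {M N} f g h := by
    apply RightComodule.hom_ext
    refine LinearMap.ext fun m => ?_
    exact congrArg (fun k : P.toRat.obj M ⟶ P.toRat.obj N => k.hom.hom m) h

/-- Colinearity is tested under α_N: at a, the two sides of the colinearity square are a f(m) and
f(a m). -/
instance : P.toRat.Full where
  map_surjective {M N} f := by
    let _ := P.comoduleModule M
    let _ := P.comoduleModule N
    have := P.comoduleModule_isScalarTower M
    have := P.comoduleModule_isScalarTower N
    let g : M.carrier →ₗ[A] N.carrier := f.hom.hom
    refine ⟨⟨g.restrictScalars R, ?_⟩, rfl⟩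
    refine LinearMap.ext fun m => P.alpha _ <| LinearMap.ext fun a => ?_
    rw [LinearMap.comp_apply, LinearMap.comp_apply, pairingAlpha_rTensor]
    exact (g.map_smul a m).symm

instance : P.toRat.EssSurj where
  mem_essImage N := ⟨P.ofRat N, ⟨eqToIso (P.toRat_obj_ofRat N)⟩⟩

theorem isEquivalence_toRat : P.toRat.IsEquivalence where

theorem bijective_toRat_obj : Function.Bijective P.toRat.obj :=
  ⟨P.toRat_obj_injective, fun N => ⟨P.ofRat N, P.toRat_obj_ofRat N⟩⟩

/-! ### Rational modules as the category subgenerated by C. -/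

theorem isRational_leftModule : P.ratProp P.leftModule :=
  (P.toRat.obj ⟨C, Coalgebra.comul, isRightCoaction_comul⟩).property

/-- A rational N is a submodule of N ⊗ C by its coaction, and N ⊗ C is generated by copies of C, one
for each element of N. Conversely C is rational, and rationality survives direct sums, quotients and
submodules. -/
theorem ratProp_eq_sigmaProp : P.ratProp = sigmaProp P.leftModule := by
  ext N
  constructor
  · intro hN
    have h : P.IsRational N := hN
    -- Here A acts through the factor C alone, so that each c ↦ n ⊗ c is A-linear; the action on N
    -- enters only through the coaction.
    let L : Module A (N ⊗[R] C) := Module.compHom (N ⊗[R] C)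
      (P.leftAct (freeCoact N C) (isRightCoaction_freeCoact N)).toRingHom
    let ins (n : N) : P.leftModule →ₗ[A] N ⊗[R] C :=
      { toFun := fun c => n ⊗ₜ (show C from c)
        map_add' := fun c d => TensorProduct.tmul_add n (show C from c) (show C from d)
        map_smul' := fun a c =>
          (MeasuringPairing.leftAct_freeCoact_tmul (Q := P.toMeasuringPairing) N a n c).symm }
    let p : (N →₀ P.leftModule) →ₗ[A] N ⊗[R] C := Finsupp.lsum ℕ ins
    let i : N →ₗ[A] N ⊗[R] C :=
      { toFun := P.ratCoact h
        map_add' := map_add _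
        -- Under α_N both sides are the function b ↦ (ba)n.
        map_smul' := fun a n => P.alpha N <| LinearMap.ext fun b => by
          rw [P.pairingAlpha_ratCoact, smul_smul, ← P.pairingAlpha_ratCoact h]
          exact (P.pairingAlpha_leftAct_freeCoact _ _ _).symm }
    refine ⟨N, ModuleCat.of A (N ⊗[R] C), p, i, ?_, ?_⟩
    · intro t
      change N ⊗[R] C at t
      induction t with
      | zero => exact ⟨0, map_zero p⟩
      | add x y hx hy =>
        obtain ⟨x, rfl⟩ := hx
        obtain ⟨y, rfl⟩ := hy
        exact ⟨x + y, map_add p x y⟩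
      | tmul n c => exact ⟨Finsupp.single n c, Finsupp.lsum_single ℕ ins n c⟩
    · intro m n hmn
      -- Evaluating the represented function at 1 recovers the element, so the coaction is
      -- injective.
      have h1 := congrArg (fun t : N ⊗[R] C => pairingAlpha P.form N t 1) hmn
      have h2 := P.pairingAlpha_ratCoact h m 1
      have h3 := P.pairingAlpha_ratCoact h n 1
      rw [one_smul] at h2 h3
      exact h2.symm.trans (h1.trans h3)
  · rintro ⟨I, X, p, i, hp, hi⟩
    exact P.isRational_of_injective i hi (P.isRational_of_surjective p hp
      (P.isRational_finsupp I P.isRational_leftModule))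

/-- The rational submodule is the trace of the rational modules. -/
theorem ratSubmodule_eq_sigmaTrace (M : ModuleCat.{u} A) :
    P.ratSubmodule M = sigmaTrace P.leftModule M := by
  apply le_antisymm
  · have h : sigmaProp P.leftModule (ModuleCat.of A (P.ratSubmodule M)) := by
      rw [← P.ratProp_eq_sigmaProp]
      exact P.ratProp_of (P.isRational_ratSubmodule M)
    exact (Submodule.range_subtype _).symm.le.trans
      (le_iSup_of_le (ModuleCat.of A (P.ratSubmodule M))
        (le_iSup_of_le h (le_iSup_of_le (P.ratSubmodule M).subtype le_rfl)))
  · refine iSup_le fun N => iSup_le fun hN => iSup_le fun f => ?_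
    rw [← P.ratProp_eq_sigmaProp] at hN
    rintro _ ⟨n, rfl⟩
    exact P.map_mem_ratSubmodule f (hN.symm ▸ Submodule.mem_top)

end MeasuringAlphaPairing

end RationalModules

/-! ### Central elements of M ⊗ D, bimodule maps from A, and A-linear maps from B. -/

section Coinduction

variable {R A B C D : Type u} [CommRing R] [Ring A] [Algebra R A] [Ring B] [Algebra R B]
  [AddCommGroup C] [Module R C] [Coalgebra R C] [AddCommGroup D] [Module R D] [Coalgebra R D]

namespace MeasuringPairing

variable {P : MeasuringPairing R A C} {Q : MeasuringPairing R B D} (φ : Q.Hom P)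
  {M : Type u} [AddCommGroup M] [Module R M]

/-- The right action of `a : A` on the second factor of `M ⊗ D`, paired with `B`, is left
multiplication by `ξ a` in the argument. -/
theorem pairingAlpha_lTensor_rightAct (t : M ⊗[R] D) (a : A) (b : B) :
    pairingAlpha Q.form M ((P.rightAct (leftCoactOfHom φ.θ) (isLeftCoaction_leftCoactOfHom φ.θ)
      (MulOpposite.op a)).lTensor M t) b = pairingAlpha Q.form M t (φ.ξ a * b) := by
  induction t with
  | zero => simp
  | add x y hx hy => simp only [map_add, LinearMap.add_apply, hx, hy]
  | tmul m d =>
    rw [LinearMap.lTensor_tmul, rightAct_apply, pairingAlpha_tmul, pairingAlpha_tmul, form_mul,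
      leftCoactOfHom, LinearMap.comp_apply]
    congr 1
    generalize (Coalgebra.comul (R := R) d) = z
    induction z with
    | zero => simp
    | tmul c d => simp [φ.adj]
    | add x y hx hy => simp only [map_add, LinearMap.add_apply, hx, hy]

variable [Module A M] [IsScalarTower R A M]

theorem envAct_tmul_one (t : M ⊗[R] D) (a : A) :
    envAct φ M (a ⊗ₜ 1) t = (Algebra.lsmul R R M a).rTensor D t := by
  induction t with
  | zero => simp
  | add x y hx hy => simp only [map_add, hx, hy]
  | tmul m d => simp [envAct_tmul]

theorem envAct_one_tmul (t : M ⊗[R] D) (a : Aᵐᵒᵖ) :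
    envAct φ M (1 ⊗ₜ a) t = (P.rightAct (leftCoactOfHom φ.θ)
      (isLeftCoaction_leftCoactOfHom φ.θ) a).lTensor M t := by
  induction t with
  | zero => simp
  | add x y hx hy => simp only [map_add, hx, hy]
  | tmul m d => simp [envAct_tmul]

/-- The elements `t` of `M ⊗ D` with `a t = t a` for all `a : A`. -/
def IsCentral (t : M ⊗[R] D) : Prop :=
  ∀ a : A, envAct φ M (a ⊗ₜ 1) t = envAct φ M (1 ⊗ₜ MulOpposite.op a) t

variable {φ}

/-- Seen as a function on B, t a is b ↦ t(ξ(a)b) and a t is b ↦ a t(b), so centrality of t is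
exactly A-linearity of its function. This direction needs no injectivity of α. -/
theorem IsCentral.pairingAlpha_mul {t : M ⊗[R] D} (ht : IsCentral φ t) (a : A) (b : B) :
    pairingAlpha Q.form M t (φ.ξ a * b) = a • pairingAlpha Q.form M t b := by
  rw [← pairingAlpha_lTensor_rightAct, ← envAct_one_tmul, ← ht, envAct_tmul_one,
    pairingAlpha_rTensor]
  rfl

/-- The map from central elements of `M ⊗ D` to `Hom_A(B, M)`. -/
def IsCentral.toCoextend {t : M ⊗[R] D} (ht : IsCentral φ t) :
    (ModuleCat.coextendScalars.{u, u, u} φ.ξ.toRingHom).obj (ModuleCat.of A M) :=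
  show (ModuleCat.restrictScalars φ.ξ.toRingHom).obj (ModuleCat.of B B) →ₗ[A] M from
  { toFun := fun b => pairingAlpha Q.form M t b
    map_add' := fun b b' => map_add (pairingAlpha Q.form M t) b b'
    map_smul' := fun a b => ht.pairingAlpha_mul a b }

theorem IsCentral.toCoextend_apply {t : M ⊗[R] D} (ht : IsCentral φ t) (b : B) :
    (show (ModuleCat.coextendScalars.{u, u, u} φ.ξ.toRingHom).obj (ModuleCat.of A M) from
      ht.toCoextend) b = pairingAlpha Q.form M t b := rfl

theorem coextend_map_mul {M : ModuleCat.{u} A}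
    (f : (ModuleCat.coextendScalars.{u, u, u} φ.ξ.toRingHom).obj M) (a : A) (b : B) :
    f (φ.ξ a * b) = a • f b :=
  LinearMap.map_smul (ModuleCat.CoextendScalars.equiv φ.ξ.toRingHom M f) a b

theorem coextend_ext {M : ModuleCat.{u} A}
    {f g : (ModuleCat.coextendScalars.{u, u, u} φ.ξ.toRingHom).obj M}
    (h : ∀ b : B, f b = g b) : f = g :=
  ModuleCat.CoextendScalars.ext (LinearMap.ext h)

attribute [local instance] instModuleTensorProductMop

/-- In the bimodule A both a ⊗ 1 and 1 ⊗ a send 1 to a; a bimodule map carries this over to its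
value at 1. -/
theorem isCentral_envHomEval (f : EnvHom φ M) : IsCentral φ (M := M) (envHomEval φ M f) := by
  intro a
  have h : (a ⊗ₜ[R] (1 : Aᵐᵒᵖ)) • (1 : A) = ((1 : A) ⊗ₜ[R] MulOpposite.op a) • (1 : A) := by
    change TensorProduct.Algebra.moduleAux _ _ = TensorProduct.Algebra.moduleAux _ _
    simp [TensorProduct.Algebra.moduleAux]
  have h1 := congrArg f h
  rw [map_smul, map_smul] at h1
  exact h1

/-- The `A^e`-linear map `a ↦ a t` for a central element `t`. -/
def IsCentral.toEnvHom {t : M ⊗[R] D} (ht : IsCentral φ t) : EnvHom φ M where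
  toFun a := envAct φ M (a ⊗ₜ 1) t
  map_add' a b := by rw [TensorProduct.add_tmul, map_add, LinearMap.add_apply]; rfl
  map_smul' s a := by
    change _ = envAct φ M s (envAct φ M (a ⊗ₜ 1) t)
    induction s with
    | zero =>
      exact (congrArg (fun x : A => envAct φ M (x ⊗ₜ 1) t)
        (zero_smul (A ⊗[R] Aᵐᵒᵖ) a)).trans (by simp)
    | add x y hx hy =>
      simp only [map_add, LinearMap.add_apply, add_smul, TensorProduct.add_tmul, hx, hy]
    | tmul x y =>
      obtain ⟨y, rfl⟩ := MulOpposite.op_surjective y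
      have h : (x ⊗ₜ[R] MulOpposite.op y) • a = x * a * y := by
        change TensorProduct.Algebra.moduleAux _ _ = _
        simp [TensorProduct.Algebra.moduleAux, mul_assoc]
      -- The two sides are xa applied to y t and to t y. Splitting off the factor xa leaves
      -- precisely the identity that centrality provides.
      have h1 : ((x * a * y) ⊗ₜ[R] (1 : Aᵐᵒᵖ)) = ((x * a) ⊗ₜ 1) * (y ⊗ₜ 1) := by simp
      have h2 : (x ⊗ₜ[R] MulOpposite.op y) * (a ⊗ₜ 1) = ((x * a) ⊗ₜ 1) * (1 ⊗ₜ MulOpposite.op y) := by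
        simp
      rw [h, h1, ← Module.End.mul_apply, ← map_mul, h2, map_mul, map_mul, Module.End.mul_apply,
        Module.End.mul_apply, ht]

theorem IsCentral.envHomEval_toEnvHom {t : M ⊗[R] D} (ht : IsCentral φ t) :
    envHomEval φ M ht.toEnvHom = t := by
  change envAct φ M (1 : A ⊗[R] Aᵐᵒᵖ) t = t
  simp

variable (φ M) in
/-- The `B`-linear map `Hom_{A^e}(A, M ⊗ D) → Hom_A(B, M)`. -/
def envHomToCoextend : EnvHom φ M →ₗ[B]
    (ModuleCat.coextendScalars.{u, u, u} φ.ξ.toRingHom).obj (ModuleCat.of A M) where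
  toFun f := (isCentral_envHomEval f).toCoextend
  map_add' f g := coextend_ext fun b =>
    LinearMap.congr_fun (map_add (pairingAlpha Q.form M) (show M ⊗[R] D from f 1) (g 1)) b
  map_smul' b f := coextend_ext fun x =>
    Q.pairingAlpha_leftAct_freeCoact (show M ⊗[R] D from f 1) x b

theorem envHomToCoextend_apply (f : EnvHom φ M) (b : B) :
    envHomToCoextend φ M f b = pairingAlpha Q.form M (envHomEval φ M f) b := rfl

/-! ### The cotensor product as the module of central elements. -/

section Cotensor

variable (ρ : M →ₗ[R] M ⊗[R] C)

/-- Moving the C-leg of M ⊗ C ⊗ D to the end lets α for the module M ⊗ D test it. The map ρ ⊗ id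
then becomes t ↦ a t, provided that ρ induces the given A-action. -/
theorem pairingAlpha_assoc_rTensor (hρ : ∀ a m, pairingAlpha P.form M (ρ m) a = a • m)
    (t : M ⊗[R] D) (a : A) :
    pairingAlpha P.form (M ⊗[R] D) ((TensorProduct.assoc R M D C).symm
      ((TensorProduct.comm R C D).toLinearMap.lTensor M
        (TensorProduct.assoc R M C D (ρ.rTensor D t)))) a = envAct φ M (a ⊗ₜ 1) t := by
  induction t with
  | zero => simp
  | add x y hx hy => simp only [map_add, LinearMap.add_apply, hx, hy]
  | tmul m d =>
    rw [LinearMap.rTensor_tmul, envAct_tmul, ← hρ, map_one, Module.End.one_apply]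
    generalize ρ m = z
    induction z with
    | zero => simp
    | add x y hx hy => simp only [map_add, LinearMap.add_apply, TensorProduct.add_tmul, hx, hy]
    | tmul m c => simp [TensorProduct.smul_tmul']

/-- The companion for the second map that defines the cotensor product: it becomes t ↦ t a. -/
theorem pairingAlpha_lTensor_leftCoactOfHom (t : M ⊗[R] D) (a : A) :
    pairingAlpha P.form (M ⊗[R] D) ((TensorProduct.assoc R M D C).symm
      ((TensorProduct.comm R C D).toLinearMap.lTensor M ((leftCoactOfHom φ.θ).lTensor M t))) a =
      envAct φ M (1 ⊗ₜ MulOpposite.op a) t := by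
  induction t with
  | zero => simp
  | add x y hx hy => simp only [map_add, LinearMap.add_apply, hx, hy]
  | tmul m d =>
    rw [LinearMap.lTensor_tmul, envAct_tmul, one_smul, rightAct_apply]
    generalize leftCoactOfHom φ.θ d = z
    induction z with
    | zero => simp
    | add x y hx hy => simp only [map_add, LinearMap.add_apply, TensorProduct.tmul_add, hx, hy]
    | tmul c d => simp

theorem isCentral_of_mem_cotensor (hρ : ∀ a m, pairingAlpha P.form M (ρ m) a = a • m)
    {t : M ⊗[R] D} (ht : t ∈ cotensor ρ (leftCoactOfHom φ.θ)) : IsCentral φ t := by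
  intro a
  rw [← pairingAlpha_assoc_rTensor ρ hρ, ← pairingAlpha_lTensor_leftCoactOfHom]
  congr 4
  exact sub_eq_zero.1 ht

end Cotensor

end MeasuringPairing

/-! ### Converses that rest on the α-condition. -/

namespace MeasuringAlphaPairing

variable {P : MeasuringPairing R A C} (Q : MeasuringAlphaPairing R B D) (φ : Q.Hom P)
  {M : Type u} [AddCommGroup M] [Module R M] [Module A M] [IsScalarTower R A M]

open MeasuringPairing

/-- Converse of `IsCentral.pairingAlpha_mul`: since α_M for Q is injective, a t and t a agree once
their functions on B do. -/
theorem isCentral_of_pairingAlpha {t : M ⊗[R] D}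
    (ht : ∀ (a : A) (b : B), pairingAlpha Q.form M t (φ.ξ a * b) = a • pairingAlpha Q.form M t b) :
    IsCentral φ t := by
  refine fun a => Q.alpha M <| LinearMap.ext fun b => ?_
  rw [envAct_one_tmul, pairingAlpha_lTensor_rightAct, ht, envAct_tmul_one, pairingAlpha_rTensor]
  rfl

attribute [local instance] baseModule baseModule_isScalarTower

/-- Rationality represents the orbit b ↦ bf by a tensor s in Hom_A(B, M) ⊗ D. Evaluating its first
leg at 1 gives an element of M ⊗ D whose function is b ↦ (bf)(1) = f(b); it is central because f is
A-linear. -/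
theorem exists_isCentral
    {f : (ModuleCat.coextendScalars.{u, u, u} φ.ξ.toRingHom).obj (ModuleCat.of A M)}
    (hf : f ∈ Q.ratSubmodule
      ((ModuleCat.coextendScalars.{u, u, u} φ.ξ.toRingHom).obj (ModuleCat.of A M))) :
    ∃ (t : M ⊗[R] D) (ht : IsCentral φ t), ht.toCoextend = f := by
  obtain ⟨s, hs⟩ := hf
  let X := (ModuleCat.coextendScalars.{u, u, u} φ.ξ.toRingHom).obj (ModuleCat.of A M)
  let ev : X →ₗ[R] M :=
    { toFun := fun g => g (1 : B)
      map_add' := fun _ _ => rfl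
      -- Scalars act on Hom_A(B, M) through B but on M through A, and ξ matches the two: g(1·r) =
      -- g(ξ(r)·1) = r g(1).
      map_smul' := fun r g => by
        change g ((1 : B) * algebraMap R B r : B) = r • (show M from g (1 : B))
        rw [one_mul, ← algebraMap_smul A r, ← φ.ξ.commutes, ← mul_one (φ.ξ _)]
        exact coextend_map_mul g _ _ }
  have h : ∀ b : B, pairingAlpha Q.form M (ev.rTensor D s) b = f b := by
    intro b
    rw [pairingAlpha_rTensor, ← hs]
    change f (1 * b : B) = _
    rw [one_mul]
  refine ⟨ev.rTensor D s, isCentral_of_pairingAlpha Q φ fun a b => ?_, coextend_ext h⟩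
  rw [h, h]
  exact coextend_map_mul f a b

/-- Here the α-condition of P is used, for the module M ⊗ D: the two defining maps of the cotensor
product agree at t because all their pairings with A do. -/
theorem mem_cotensor_of_isCentral (P : MeasuringAlphaPairing R A C)
    {φ : Q.Hom P.toMeasuringPairing} (ρ : M →ₗ[R] M ⊗[R] C)
    (hρ : ∀ a m, pairingAlpha P.form M (ρ m) a = a • m) {t : M ⊗[R] D} (ht : IsCentral φ t) :
    t ∈ cotensor ρ (leftCoactOfHom φ.θ) := by
  let e : M ⊗[R] (C ⊗[R] D) ≃ₗ[R] (M ⊗[R] D) ⊗[R] C :=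
    (TensorProduct.comm R C D).lTensor M ≪≫ₗ (TensorProduct.assoc R M D C).symm
  refine sub_eq_zero.2 (e.injective (P.alpha _ (LinearMap.ext fun a => ?_)))
  exact (pairingAlpha_assoc_rTensor ρ hρ t a).trans
    ((ht a).trans (pairingAlpha_lTensor_leftCoactOfHom t a).symm)

/-- A rational module that embeds into `X` with image containing all rational elements of `X`
is isomorphic to `Rat^D(X)`. -/
def ratIso (N : Q.RatCat) (X : ModuleCat.{u} B) (g : N.obj →ₗ[B] X)
    (hg : Function.Injective g) (hr : ∀ x ∈ Q.ratSubmodule X, ∃ n, g n = x) :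
    N ≅ Q.ratFunctor.obj X :=
  ObjectProperty.isoMk _ (LinearEquiv.toModuleIso (LinearEquiv.ofBijective
    (g.codRestrict (Q.ratSubmodule X) fun n =>
      Q.map_mem_ratSubmodule g (N.property.symm ▸ Submodule.mem_top))
    ⟨fun _ _ h => hg (congrArg Subtype.val h), fun x => by
      obtain ⟨n, hn⟩ := hr x.1 x.2
      exact ⟨n, Subtype.ext hn⟩⟩))

end MeasuringAlphaPairing
end Coinduction

/-! ### The natural equivalences between the four functors. -/

section Equivalences

variable {R A B C D : Type u} [CommRing R] [Ring A] [Algebra R A] [Ring B] [Algebra R B]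
  [AddCommGroup C] [Module R C] [Coalgebra R C] [AddCommGroup D] [Module R D] [Coalgebra R D]
  {P : MeasuringAlphaPairing R A C} {Q : MeasuringAlphaPairing R B D}
  (φ : Q.Hom P.toMeasuringPairing)

namespace MeasuringAlphaPairing

open MeasuringPairing

section

variable (M : Type u) [AddCommGroup M] [Module R M] [Module A M] [IsScalarTower R A M]

/-- The map is evaluation at 1 followed by α_M, and both are injective. -/
theorem envHomToCoextend_injective : Function.Injective (envHomToCoextend φ M) := by
  intro f g h
  refine envHomEval_injective φ (Q.alpha M (LinearMap.ext fun b => ?_))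
  rw [← envHomToCoextend_apply, h, envHomToCoextend_apply]

attribute [local instance] baseModule baseModule_isScalarTower

theorem exists_envHomToCoextend
    (x : (ModuleCat.coextendScalars.{u, u, u} φ.ξ.toRingHom).obj (ModuleCat.of A M))
    (hx : x ∈ Q.ratSubmodule
      ((ModuleCat.coextendScalars.{u, u, u} φ.ξ.toRingHom).obj (ModuleCat.of A M))) :
    ∃ f : EnvHom φ M, envHomToCoextend φ M f = x := by
  obtain ⟨t, ht, rfl⟩ := Q.exists_isCentral φ hx
  refine ⟨ht.toEnvHom, coextend_ext fun b => ?_⟩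
  rw [envHomToCoextend_apply, ht.envHomEval_toEnvHom, ht.toCoextend_apply]

end

attribute [local instance] baseModule baseModule_isScalarTower

/-- `Hom_{A^e}(A, M ⊗ D) ≅ Rat^D(Hom_A(B, M))`, naturally in `M`. -/
def envHomIsoCoind : envHomFunctor φ ≅ coind φ :=
  NatIso.ofComponents
    (fun M => Q.ratIso _ _ (envHomToCoextend φ M.obj) (envHomToCoextend_injective φ M.obj)
      (exists_envHomToCoextend φ M.obj))
    (fun {M N} g => by
      apply ObjectProperty.hom_ext
      apply ModuleCat.hom_ext
      refine LinearMap.ext fun f => Subtype.ext <| coextend_ext fun b => ?_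
      -- Naturality in M is the naturality of α.
      exact pairingAlpha_rTensor Q.form (g.hom.hom.restrictScalars R) (envHomEval φ M.obj f) b)

section

variable (M : RightComodule R C)

theorem isCentral_cotensor (t : cotensor M.coact (leftCoactOfHom φ.θ)) :
    letI := P.comoduleModule M
    haveI := P.comoduleModule_isScalarTower M
    IsCentral φ t.1 :=
  letI := P.comoduleModule M
  haveI := P.comoduleModule_isScalarTower M
  isCentral_of_mem_cotensor M.coact (fun _ _ => rfl) t.2

/-- The `B`-linear map `M □_C D → Hom_A(B, M)`. -/
def cotensorToCoextend : (Q.toRat.obj ((cotensorFunctor φ).obj M)).obj →ₗ[B]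
    (ModuleCat.coextendScalars.{u, u, u} φ.ξ.toRingHom).obj (P.toRat.obj M).obj :=
  letI := P.comoduleModule M
  haveI := P.comoduleModule_isScalarTower M
  haveI : Module.Flat R D := Q.alpha.flat
  { toFun := fun t => (isCentral_cotensor φ M t).toCoextend
    map_add' := fun s t => coextend_ext fun b =>
      LinearMap.congr_fun (map_add (pairingAlpha Q.form M.carrier)
        (show cotensor M.coact (leftCoactOfHom φ.θ) from s).1
        (show cotensor M.coact (leftCoactOfHom φ.θ) from t).1) b
    map_smul' := fun b t => coextend_ext fun x => by
      let T := cotensor M.coact (leftCoactOfHom φ.θ)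
      let s : T := t
      -- The action of B on M □_C D is defined by its own coaction. Since that coaction restricts id
      -- ⊗ Δ_D, the inclusion into M ⊗ D turns it into the action on the factor D.
      have h : T.subtype (pairingAlpha Q.form T (cotensorCoact M.coact φ.θ s) b) =
          Q.leftAct (freeCoact M.carrier D) (isRightCoaction_freeCoact M.carrier) b s.1 := by
        rw [← pairingAlpha_rTensor]
        exact congrArg (fun z => pairingAlpha Q.form (M.carrier ⊗[R] D) z b)
          (LinearMap.congr_fun (rTensor_cotensorCoact M.coact φ.θ) s)
      refine (congrArg (fun z => pairingAlpha Q.form M.carrier z x) h).trans ?_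
      exact Q.pairingAlpha_leftAct_freeCoact s.1 x b }

theorem cotensorToCoextend_injective : Function.Injective (cotensorToCoextend φ M) := by
  intro s t h
  refine Subtype.ext (Q.alpha M.carrier (LinearMap.ext fun b => ?_))
  exact congrArg (fun f : (ModuleCat.coextendScalars.{u, u, u} φ.ξ.toRingHom).obj
    (P.toRat.obj M).obj => f b) h

attribute [local instance] baseModule baseModule_isScalarTower

theorem exists_cotensorToCoextend
    (x : (ModuleCat.coextendScalars.{u, u, u} φ.ξ.toRingHom).obj (P.toRat.obj M).obj)
    (hx : x ∈ Q.ratSubmodule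
      ((ModuleCat.coextendScalars.{u, u, u} φ.ξ.toRingHom).obj (P.toRat.obj M).obj)) :
    ∃ t, cotensorToCoextend φ M t = x := by
  let _ := P.comoduleModule M
  have := P.comoduleModule_isScalarTower M
  obtain ⟨t, ht, rfl⟩ := Q.exists_isCentral (M := M.carrier) φ hx
  exact ⟨⟨t, Q.mem_cotensor_of_isCentral P M.coact (fun _ _ => rfl) ht⟩, rfl⟩

end

/-- `M □_C D ≅ Rat^D(Hom_A(B, M))`, naturally in the right `C`-comodule `M`. -/
def cotensorIsoCoind : cotensorFunctor φ ⋙ Q.toRat ≅ P.toRat ⋙ coind φ :=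
  NatIso.ofComponents
    (fun M => Q.ratIso _ _ (cotensorToCoextend φ M) (cotensorToCoextend_injective φ M)
      (exists_cotensorToCoextend φ M))
    (fun {M N} g => by
      apply ObjectProperty.hom_ext
      apply ModuleCat.hom_ext
      refine LinearMap.ext fun t => Subtype.ext <| coextend_ext fun b => ?_
      exact pairingAlpha_rTensor Q.form (RightComodule.Hom.toLin g)
        (show cotensor M.coact (leftCoactOfHom φ.θ) from t).1 b)

/-- On the equal categories `Rat^C(_A M) = σ[_A C]` and `Rat^D(_B M) = σ[_B D]` the functors
`Coind_P^Q` and `Coind_C^D` agree. -/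
def coindIsoSigmaCoind (hP : P.ratProp = sigmaProp P.leftModule)
    (hQ : Q.ratProp = sigmaProp Q.leftModule) :
    coind φ ⋙ ObjectProperty.ιOfLE hQ.le ≅ ObjectProperty.ιOfLE hP.le ⋙ sigmaCoind φ :=
  NatIso.ofComponents
    (fun M => ObjectProperty.isoMk _ (LinearEquiv.toModuleIso (LinearEquiv.ofEq _ _
      (Q.ratSubmodule_eq_sigmaTrace
        ((ModuleCat.coextendScalars.{u, u, u} φ.ξ.toRingHom).obj M.obj)))))
    -- Rat and Sp are the same submodule, so each component is the identity on elements.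
    (fun _ => rfl)

end MeasuringAlphaPairing

end Equivalences

end

/-- Isomorphism of categories is expressed as an equivalence that is bijective on objects. The
cotensor functor is compared after transport along `toRat`, and the functor on σ-categories along
the inclusions given by the equalities `hP` and `hQ`, which are bound in the conclusion for that
purpose. -/
theorem mainTheorem3 {R A B C D : Type u} [CommRing R] [Ring A] [Algebra R A]
    [Ring B] [Algebra R B] [AddCommGroup C] [Module R C] [Coalgebra R C]
    [AddCommGroup D] [Module R D] [Coalgebra R D]
    (P : MeasuringAlphaPairing R A C) (Q : MeasuringAlphaPairing R B D)
    (φ : Q.toMeasuringPairing.Hom P.toMeasuringPairing) :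
    (P.toRat.IsEquivalence ∧ Function.Bijective P.toRat.obj) ∧
    (Q.toRat.IsEquivalence ∧ Function.Bijective Q.toRat.obj) ∧
    Nonempty (cotensorFunctor φ ⋙ Q.toRat ≅ P.toRat ⋙ coind φ) ∧
    Nonempty (coind φ ≅ envHomFunctor φ) ∧
    ∃ (hP : P.ratProp = sigmaProp P.leftModule) (hQ : Q.ratProp = sigmaProp Q.leftModule),
      Nonempty (coind φ ⋙ ObjectProperty.ιOfLE hQ.le ≅
        ObjectProperty.ιOfLE hP.le ⋙ sigmaCoind φ) :=
  ⟨⟨P.isEquivalence_toRat, P.bijective_toRat_obj⟩, ⟨Q.isEquivalence_toRat, Q.bijective_toRat_obj⟩,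
    ⟨MeasuringAlphaPairing.cotensorIsoCoind φ⟩, ⟨(MeasuringAlphaPairing.envHomIsoCoind φ).symm⟩,
    P.ratProp_eq_sigmaProp, Q.ratProp_eq_sigmaProp,
    ⟨MeasuringAlphaPairing.coindIsoSigmaCoind φ P.ratProp_eq_sigmaProp Q.ratProp_eq_sigmaProp⟩⟩
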